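/- Let $A$ be a finite alphabet and $\xi$ an endomorphism of the free monoid $A^*$ that is a substitution: some $\xi(a)$ begins with $a$, and $|\xi^n(b)|\to\infty$ for every $b\in A$. Let $M=(m_{i,j})_{i,j\in A}$ be its incidence matrix, $m_{i,j}$ being the number of occurrences of $i$ in $\xi(j)$. Let $\Omega\subset A^{\mathbb Z}$ be the set of bi-infinite sequences all of whose factors occur in some $\xi^n(b)$ ($n\ge 0$, $b\in A$), $S$ the shift $(Sx)_i=x_{i+1}$, $[a]=\{x\in\Omega : x_0=a\}$, and $\mu$ the unique shift-invariant Borel probability measure on $\Omega$. Let $E^s\subset\mathbb R^A$ be the sum of the real generalized eigenspaces of $M^t$ for its eigenvalues $z$ with $0<|z|<1$; that is, $E^s$ is the space of all $v\in\bigcap_{k}\operatorname{im}\,(M^t)^k$ with $(M^t)^k v\to 0$. Write $d-1=\dim E^s$. Assume Hypotheses P: $\xi$ is primitive (some power $M^k$, $k\geq 1$, has only positive entries) and proper (all $\xi(b)$, $b\in A$, begin with one and the same letter, and all end with one and the same letter), and i) the characteristic polynomial of $M$ has exactly one complex root of modulus greater than $1$; ii) $\alpha_1,\dots,\alpha_{d-1}$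 are real numbers such that $1,\alpha_1,\dots,\alpha_{d-1}$ are linearly independent over $\mathbb Q$ and every $\exp(2\pi i\alpha_j)$ is an eigenvalue of $(\Omega,\mu,S)$, with a nonzero eigenfunction in $L^2(\mu)$; iii) $\beta\,|\det(M^t|_{E^s})|=1$, where $\beta$ is the Perron (dominant) eigenvalue of $M$. For each $j$ let $v(j)$ be the unique vector of $E^s$ for which $(M^t)^m\big(\alpha_j(1,\dots,1)^t-v(j)\big)\in\mathbb Z^A$ for some $m\ge 0$. (It exists because $\exp(2\pi i\alpha_j)$ is an eigenvalue.) For $n\ge 1$ and $x\in\Omega$ let $r_n(x)=\min\{k\ge 0 : S^kx\in\xi^{n-1}(\Omega)\}$; for $k\ge 1$ and $a\in A$ let $$s_k(x)_a=\#\{\,i : r_k(x)\le i<r_{k+1}(x),\ S^ix\in\xi^{k-1}([a])\,\},$$ and define $F:\Omega\to\mathbb R^{d-1}$ by $$F(x)=\Big(\sum_{k\ge 1}\big\langle s_k(x),(M^t)^k v(j)\big\rangle\Big)_{1\le j\le d-1}.$$ Then these series converge absolutely for every $x\in\Omega$, and, with $\lambda$ denoting Lebesgue measure on $\mathbb R^{d-1}$,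 there is a finite constant $C\ge 0$ such that for every letter $a\in A$: 1. $\lambda(F([a]))=C\,\mu([a])$; 2. for every sufficiently large integer $n$, $F([a])$ is the union of the sets $F(S^{k}\xi^n([b]))$ over all pairs $(b,k)$ with $b\in A$, $0\le k<|\xi^n(b)|$ and $[a]\cap S^{k}\xi^n([b])\ne\emptyset$, and any two of these sets with distinct indices $(b,k)$ intersect in a set of $\lambda$-measure zero; 3. for every Borel set $B\subset[a]$, the set $F(B)$ is Lebesgue measurable and $\lambda(F(B))=C\,\mu(B)$. -/

import Mathlib

open MeasureTheory Filter Topology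
open scoped NNReal

noncomputable section

namespace PrimSubst

section Words

variable {A : Type*}

/-- `ξ ^ n` on letters, for the endomorphism of the free monoid of words given by the images
`ξ a` of the letters. -/
def substPow (ξ : A → List A) (n : ℕ) (a : A) : List A :=
  (fun w : List A => w.flatMap ξ)^[n] [a]

/-- The language of `ξ`: all words occurring in some `ξ ^ n (b)`. -/
def language (ξ : A → List A) : Set (List A) :=
  {w | ∃ (n : ℕ) (b : A), w <:+: substPow ξ n b}

/-- The factor of length `n` of a bi-infinite sequence that starts at position `i`. -/
def factor (x : ℤ → A) (i : ℤ) (n : ℕ) : List A :=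
  List.ofFn fun k : Fin n => x (i + (k : ℕ))

/-- The substitutive subshift: all bi-infinite sequences whose factors lie in the language. -/
def Omega (ξ : A → List A) : Set (ℤ → A) :=
  {x | ∀ (i : ℤ) (n : ℕ), factor x i n ∈ language ξ}

/-- The shift on bi-infinite sequences. -/
def shift (x : ℤ → A) : ℤ → A := fun i => x (i + 1)

/-- The cylinder set of a letter: the points of the subshift whose coordinate `0` is `a`. -/
def cyl (ξ : A → List A) (a : A) : Set (ℤ → A) := {x | x ∈ Omega ξ ∧ x 0 = a}

/-- `y` is the image of the sequence `x` under the morphism `τ`, i.e. the concatenation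
`⋯ τ(x₋₁) . τ(x₀) τ(x₁) ⋯`: the block `τ (x j)` occupies the positions from `c j` on. -/
def IsImage (τ : A → List A) (x y : ℤ → A) : Prop :=
  ∃ c : ℤ → ℤ, c 0 = 0 ∧ (∀ j, c (j + 1) = c j + ((τ (x j)).length : ℤ)) ∧
    ∀ (j : ℤ) (k : ℕ) (hk : k < (τ (x j)).length), y (c j + (k : ℤ)) = (τ (x j))[k]

/-- `ξ ^ n (X)`, the image of a set of bi-infinite sequences under the morphism `ξ ^ n`. -/
def imagePow (ξ : A → List A) (n : ℕ) (X : Set (ℤ → A)) : Set (ℤ → A) :=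
  {y | ∃ x ∈ X, IsImage (substPow ξ n) x y}

/-- The piece `S ^ k (ξ ^ n ([b]))` of the Kakutani-Rohlin partition of level `n`
(to be used for `k < |ξ ^ n (b)|`). -/
def towerPiece (ξ : A → List A) (n k : ℕ) (b : A) : Set (ℤ → A) :=
  shift^[k] '' imagePow ξ n (cyl ξ b)

/-- The indices `(b, k)`, `0 ≤ k < |ξ ^ n (b)|`, of the level `n` pieces that meet `[a]`. -/
def towerIndex (ξ : A → List A) (n : ℕ) (a : A) : Set (A × ℕ) :=
  {p | p.2 < (substPow ξ n p.1).length ∧ (cyl ξ a ∩ towerPiece ξ n p.2 p.1).Nonempty}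

/-- The entrance time of `x` in the base `ξ ^ n (Ω)`, i.e. the least `k ≥ 0` such that
`S ^ k x` lies in the base. -/
def entrance (ξ : A → List A) (n : ℕ) (x : ℤ → A) : ℕ :=
  sInf {k : ℕ | shift^[k] x ∈ imagePow ξ n (Omega ξ)}

/-- The number of visits of the orbit of `x` to `ξ ^ n ([a])` from the entrance in
`ξ ^ n (Ω)` on and strictly before the entrance in `ξ ^ (n + 1) (Ω)`. -/
def visits (ξ : A → List A) (n : ℕ) (x : ℤ → A) (a : A) : ℕ :=
  Set.ncard {i : ℕ | entrance ξ n x ≤ i ∧ i < entrance ξ (n + 1) x ∧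
    shift^[i] x ∈ imagePow ξ n (cyl ξ a)}

/-- `ξ` is a substitution: some `ξ(a)` begins with `a`, and all `|ξ ^ n (b)|` tend to infinity. -/
def IsSubstitution (ξ : A → List A) : Prop :=
  (∃ a, (ξ a).head? = some a) ∧
    ∀ b, Tendsto (fun n => (substPow ξ n b).length) atTop atTop

/-- All words `ξ(b)` begin with the same letter, and all of them end with the same letter. -/
def IsProper (ξ : A → List A) : Prop :=
  (∃ a, ∀ b, (ξ b).head? = some a) ∧ (∃ c, ∀ b, (ξ b).getLast? = some c)

end Words

section Spectral

variable {A : Type*} [Fintype A] [DecidableEq A]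

/-- The incidence matrix: the entry `(i, j)` is the number of occurrences of `i` in `ξ(j)`. -/
def incidence (ξ : A → List A) : Matrix A A ℝ :=
  Matrix.of fun i j => (((ξ j).count i : ℕ) : ℝ)

/-- The transpose of the incidence matrix as a linear endomorphism of `ℝ^A`. -/
def transposeMap (ξ : A → List A) : (A → ℝ) →ₗ[ℝ] (A → ℝ) :=
  (incidence ξ).transpose.mulVecLin

/-- The set of complex roots of the characteristic polynomial of the incidence matrix. -/
def complexRoots (ξ : A → List A) : Set ℂ :=
  {z | ((incidence ξ).charpoly.map (algebraMap ℝ ℂ)).IsRoot z}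

/-- `β` is the Perron number: a real root of the characteristic polynomial that is strictly
greater than the modulus of any other root. -/
def IsPerronNumber (ξ : A → List A) (β : ℝ) : Prop :=
  (β : ℂ) ∈ complexRoots ξ ∧ ∀ z ∈ complexRoots ξ, z ≠ (β : ℂ) → ‖z‖ < β

/-- The vectors `v` with `f ^ k v → 0`. -/
def contracted (f : (A → ℝ) →ₗ[ℝ] (A → ℝ)) : Submodule ℝ (A → ℝ) where
  carrier := {v | Tendsto (fun k : ℕ => (f ^ k) v) atTop (𝓝 0)}
  zero_mem' := by simp
  add_mem' := by
    intro u v hu hv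
    have h := Tendsto.add hu hv
    simpa using h
  smul_mem' := by
    intro c v hv
    have h := Tendsto.const_smul hv c
    simpa using h

/-- The stable space `E^s` of the transposed incidence matrix `f`: the `v` with `f ^ k v → 0` that
have no component in the generalized kernel of `f` (the eventual range `⋂ k, range (f ^ k)` is the
sum of the generalized eigenspaces of the nonzero eigenvalues), i.e. the sum of the real
generalized eigenspaces of the eigenvalues `z` with `0 < |z| < 1`. -/
def Es (ξ : A → List A) : Submodule ℝ (A → ℝ) :=
  contracted (transposeMap ξ) ⊓ ⨅ k : ℕ, LinearMap.range (transposeMap ξ ^ k)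

theorem transposeMap_mem_Es (ξ : A → List A) :
    ∀ v ∈ Es ξ, transposeMap ξ v ∈ Es ξ := by
  intro v hv
  obtain ⟨h1, h2⟩ := Submodule.mem_inf.1 hv
  refine Submodule.mem_inf.2 ⟨?_, ?_⟩
  · have h : Tendsto (fun k : ℕ => (transposeMap ξ ^ (k + 1)) v) atTop (𝓝 0) :=
      (tendsto_add_atTop_iff_nat 1).2 h1
    simpa [contracted, pow_succ] using h
  · rw [Submodule.mem_iInf] at h2 ⊢
    intro k
    obtain ⟨u, hu⟩ := h2 k
    refine ⟨transposeMap ξ u, ?_⟩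
    rw [← hu, ← Module.End.mul_apply, ← Module.End.mul_apply, ← pow_succ, ← pow_succ']

/-- The determinant of the transposed incidence matrix restricted to `E^s`. -/
def detEs (ξ : A → List A) : ℝ :=
  LinearMap.det ((transposeMap ξ).restrict (transposeMap_mem_Es ξ))

/-- `v` is the stable part of `α (1, …, 1)`: it lies in `E^s`, and `w = α (1, …, 1) - v` is
mapped to an integer vector by some power of the transposed incidence matrix. -/
def IsStablePart (ξ : A → List A) (α : ℝ) (v : A → ℝ) : Prop :=
  v ∈ Es ξ ∧ ∃ (m : ℕ) (z : A → ℤ),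
    (transposeMap ξ ^ m) (fun a => α - v a) = fun a => (z a : ℝ)

theorem exists_int_pow (ξ : A → List A) (k : ℕ) (z : A → ℤ) :
    ∃ y : A → ℤ, (transposeMap ξ ^ k) (fun a => (z a : ℝ)) = fun a => (y a : ℝ) := by
  induction k with
  | zero => exact ⟨z, by simp⟩
  | succ k ih =>
    obtain ⟨y, hy⟩ := ih
    refine ⟨fun a => ∑ b, (((ξ a).count b : ℕ) : ℤ) * y b, ?_⟩
    rw [pow_succ', Module.End.mul_apply, hy]
    funext a
    simp [transposeMap, incidence, Matrix.vecMul, dotProduct, mul_comm]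

/-- There is at most one stable part. -/
theorem IsStablePart.unique {ξ : A → List A} {α : ℝ} {u v : A → ℝ}
    (hu : IsStablePart ξ α u) (hv : IsStablePart ξ α v) : u = v := by
  obtain ⟨hu1, m, z, hz⟩ := hu
  obtain ⟨hv1, l, y, hy⟩ := hv
  have hd : u - v ∈ Es ξ := Submodule.sub_mem _ hu1 hv1
  obtain ⟨h1, h2⟩ := Submodule.mem_inf.1 hd
  have key : ∀ k : ℕ, ∃ w : A → ℤ,
      (transposeMap ξ ^ (k + (m + l))) (u - v) = fun a => (w a : ℝ) := by
    intro k
    obtain ⟨p, hp⟩ := exists_int_pow ξ (k + l) z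
    obtain ⟨q, hq⟩ := exists_int_pow ξ (k + m) y
    refine ⟨q - p, ?_⟩
    have e : u - v = (fun a => α - v a) - (fun a => α - u a) := by
      funext a
      simp
    have e1 : (transposeMap ξ ^ (k + (m + l))) (fun a => α - u a) = fun a => (p a : ℝ) := by
      rw [← hp, ← hz, ← Module.End.mul_apply, ← pow_add]
      congr 2
      omega
    have e2 : (transposeMap ξ ^ (k + (m + l))) (fun a => α - v a) = fun a => (q a : ℝ) := by
      rw [← hq, ← hy, ← Module.End.mul_apply, ← pow_add]
      congr 2
      omega
    rw [e, map_sub, e1, e2]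
    funext a
    simp
  have h3 : Tendsto (fun k : ℕ => (transposeMap ξ ^ (k + (m + l))) (u - v)) atTop (𝓝 0) :=
    (tendsto_add_atTop_iff_nat (m + l)).2 h1
  obtain ⟨k, hk⟩ := ((Metric.tendsto_nhds.1 h3) 1 one_pos).exists
  have h4 : (transposeMap ξ ^ (k + (m + l))) (u - v) = 0 := by
    obtain ⟨w, hw⟩ := key k
    rw [hw] at hk ⊢
    rw [dist_zero_right, pi_norm_lt_iff one_pos] at hk
    funext a
    have ha := hk a
    rw [Real.norm_eq_abs] at ha
    have hb : |w a| < 1 := by exact_mod_cast ha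
    simp [Int.abs_lt_one_iff.1 hb]
  have h5 : u - v ∈ ⨆ j : ℕ, LinearMap.ker (transposeMap ξ ^ j) :=
    Submodule.mem_iSup_of_mem _ (LinearMap.mem_ker.2 h4)
  have h6 := (Submodule.disjoint_def.1
    (LinearMap.isCompl_iSup_ker_pow_iInf_range_pow (transposeMap ξ)).disjoint) _ h5 h2
  exact sub_eq_zero.1 h6

open Classical in
/-- The stable part `v` of `α (1, …, 1)`; it exists if `exp (2πiα)` is an eigenvalue of the
subshift (and is set to `0` for the `α` without a stable part). -/
def stablePart (ξ : A → List A) (α : ℝ) : A → ℝ :=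
  if h : ∃ v, IsStablePart ξ α v then h.choose else 0

/-- The `k`-th term (`k ≥ 0`) of the series for `F`: the vector with coordinates
`⟨s_{k+1}(x), (Mᵗ)^(k+1) v(i)⟩`, where `s_{k+1} = visits ξ k` and `v(i)` is the stable part of
`α i (1, …, 1)`. -/
def Fterm (ξ : A → List A) {n : ℕ} (α : Fin n → ℝ) (x : ℤ → A) (k : ℕ) : Fin n → ℝ :=
  fun i => ∑ a, (visits ξ k x a : ℝ) * (transposeMap ξ ^ (k + 1)) (stablePart ξ (α i)) a

/-- The map `F`, the sum of the series. -/
def F (ξ : A → List A) {n : ℕ} (α : Fin n → ℝ) (x : ℤ → A) : Fin n → ℝ :=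
  ∑' k : ℕ, Fterm ξ α x k

end Spectral

section Measure

variable {A : Type*} [MeasurableSpace A]

/-- `z` is an eigenvalue of the shift on `(ℤ → A, μ)`, with a nonzero eigenfunction in `L²`. -/
def IsEigenvalue (μ : Measure (ℤ → A)) (z : ℂ) : Prop :=
  ∃ f : (ℤ → A) → ℂ, MemLp f 2 μ ∧ ¬ f =ᵐ[μ] 0 ∧ (fun x => f (shift x)) =ᵐ[μ] fun x => z * f x

/-- `μ` is an invariant probability measure of the subshift of `ξ`. -/
structure IsInvariantProb (ξ : A → List A) (μ : Measure (ℤ → A)) : Prop where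
  prob : IsProbabilityMeasure μ
  invariant : MeasurePreserving shift μ μ
  support : μ (Omega ξ)ᶜ = 0

/-- The standing hypotheses on the substitution `ξ`, with `n = d - 1`. -/
structure HypothesesP [Fintype A] [DecidableEq A] (ξ : A → List A) (μ : Measure (ℤ → A))
    {n : ℕ} (α : Fin n → ℝ) : Prop where
  substitution : IsSubstitution ξ
  primitive : (incidence ξ).IsPrimitive
  proper : IsProper ξ
  unique_root : ∃! z : ℂ, z ∈ complexRoots ξ ∧ 1 < ‖z‖
  dim_stable : Module.finrank ℝ (Es ξ) = n
  eigenvalue : ∀ i, IsEigenvalue μ (Complex.exp (2 * Real.pi * Complex.I * (α i : ℂ)))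
  independent : LinearIndependent ℚ (Fin.cons 1 α : Fin (n + 1) → ℝ)
  unimodular : ∃ β : ℝ, IsPerronNumber ξ β ∧ β * |detEs ξ| = 1

end Measure

end PrimSubst

end

/-! An eigenvalue exp(2πiα) with α irrational forbids a common period of the points of Ω, and for
aperiodic primitive ξ every point of Ω is, up to reindexing, in exactly one way a concatenation of
words ξ^m(b) (`recognizable`). So the pieces S^k ξ^m([b]) partition Ω, and entrance times and visits
can be read off the tiling.

The partial sums of the series are weights of prefixes of x (`Recognizable.sum_pairing`). Hence F on
a piece of level m is a translate of B^m ∘ F ∘ (desubstitution), where B is the matrix of M^t on E^s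
in the vectors v(j). If these form a basis, |det B| = 1/β, so λ(F(S^k ξ^m([b]))) = β^(-m) λ(F([b]));
if they are dependent, F takes values in a hyperplane and all volumes vanish
(`Recognizable.volume_image_towerPiece`).

Each [a] is a union of pieces, so the vector Λ = (λ(F([a])))_a satisfies β^k Λ ≤ M^k Λ, and
Perron-Frobenius makes Λ a multiple of the Perron vector. By invariance the vector of measures of
the bases ξ^m([b]) is a multiple of it as well. So λ(F(piece)) = C μ(piece) for all pieces, with one
constant C (`Recognizable.exists_volume_image_towerPiece_eq`).

The rest is measure theory. Properness makes the pieces generate the topology, so λ(F(B)) ≤ C μ(B)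
for open sets and then, by outer regularity, for all subsets of Ω. Since equality holds for [a],
applying the bound to B and to [a] \ B forces equality for Borel B (`Recognizable.volume_image_eq`).
Equality for a union of two pieces then gives the null overlaps. -/

noncomputable section

namespace PrimSubst

/-! ### Words and iterates of the morphism -/

section Words

variable {A : Type*} {ξ : A → List A}

@[simp] theorem substPow_zero (ξ : A → List A) (a : A) : substPow ξ 0 a = [a] := rfl

@[simp] theorem substPow_one (ξ : A → List A) (a : A) : substPow ξ 1 a = ξ a := by
  simp [substPow]

/-- The image of a word under `ξ ^ m`. -/
def expand (ξ : A → List A) (m : ℕ) (w : List A) : List A := w.flatMap (substPow ξ m)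

@[simp] theorem expand_nil (m : ℕ) : expand ξ m [] = [] := rfl

@[simp] theorem expand_append (m : ℕ) (u v : List A) :
    expand ξ m (u ++ v) = expand ξ m u ++ expand ξ m v := List.flatMap_append

@[simp] theorem expand_singleton (m : ℕ) (a : A) : expand ξ m [a] = substPow ξ m a := by
  simp [expand]

theorem expand_cons (m : ℕ) (a : A) (w : List A) :
    expand ξ m (a :: w) = substPow ξ m a ++ expand ξ m w := by
  simp [expand]

@[simp] theorem expand_zero (w : List A) : expand ξ 0 w = w := by
  induction w with
  | nil => rfl
  | cons a w ih => rw [expand_cons, ih]; simp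

theorem iterate_flatMap_append (m : ℕ) (u v : List A) :
    (fun w : List A => w.flatMap ξ)^[m] (u ++ v) =
      (fun w : List A => w.flatMap ξ)^[m] u ++ (fun w : List A => w.flatMap ξ)^[m] v := by
  induction m generalizing u v with
  | zero => rfl
  | succ m ih => simp only [Function.iterate_succ_apply, List.flatMap_append, ih]

theorem expand_eq_iterate (m : ℕ) (w : List A) :
    expand ξ m w = (fun w : List A => w.flatMap ξ)^[m] w := by
  induction w with
  | nil =>
    induction m with
    | zero => rfl
    | succ m ih => rw [Function.iterate_succ_apply]; simpa using ih
  | cons a w ih =>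
    rw [expand_cons, ih, ← List.singleton_append, iterate_flatMap_append]; rfl

theorem expand_expand (m n : ℕ) (w : List A) :
    expand ξ m (expand ξ n w) = expand ξ (n + m) w := by
  rw [expand_eq_iterate, expand_eq_iterate, expand_eq_iterate, add_comm n m,
    Function.iterate_add_apply]

theorem substPow_add (m n : ℕ) (a : A) :
    substPow ξ (m + n) a = expand ξ n (substPow ξ m a) := by
  rw [← expand_singleton, ← expand_expand, expand_singleton]

theorem IsProper.ne_nil (h : IsProper ξ) (b : A) : ξ b ≠ [] := by
  obtain ⟨⟨a, ha⟩, -⟩ := h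
  intro hb
  have := ha b
  simp [hb] at this

theorem substPow_ne_nil (hne : ∀ b, ξ b ≠ []) (m : ℕ) (b : A) : substPow ξ m b ≠ [] := by
  induction m with
  | zero => simp
  | succ m ih =>
    rw [substPow_add]
    obtain ⟨a, w, h⟩ := List.exists_cons_of_ne_nil ih
    rw [h, expand_cons]
    simp [hne a]

theorem length_substPow_pos (hne : ∀ b, ξ b ≠ []) (m : ℕ) (b : A) :
    0 < (substPow ξ m b).length :=
  List.length_pos_iff.2 (substPow_ne_nil hne m b)

theorem length_le_length_expand (hne : ∀ b, ξ b ≠ []) (m : ℕ) (w : List A) :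
    w.length ≤ (expand ξ m w).length := by
  induction w with
  | nil => simp
  | cons a w ih =>
    have := length_substPow_pos hne m a
    rw [expand_cons, List.length_append, List.length_cons]
    omega

theorem length_expand_le {m C : ℕ} (h : ∀ a, (substPow ξ m a).length ≤ C) (w : List A) :
    (expand ξ m w).length ≤ w.length * C := by
  induction w with
  | nil => simp
  | cons a w ih =>
    have := h a
    rw [expand_cons, List.length_append, List.length_cons, add_mul]
    omega

theorem le_length_expand {m c : ℕ} (h : ∀ a, c ≤ (substPow ξ m a).length) (w : List A) :
    w.length * c ≤ (expand ξ m w).length := by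
  induction w with
  | nil => simp
  | cons a w ih =>
    have := h a
    rw [expand_cons, List.length_append, List.length_cons, add_mul]
    omega

theorem substPow_infix_expand (m : ℕ) {a : A} {w : List A} (h : a ∈ w) :
    substPow ξ m a <:+: expand ξ m w := by
  obtain ⟨u, v, rfl⟩ := List.append_of_mem h
  exact ⟨expand ξ m u, expand ξ m v, by simp [expand_cons]⟩

theorem expand_infix (m : ℕ) {u w : List A} (h : u <:+: w) : expand ξ m u <:+: expand ξ m w := by
  obtain ⟨s, t, rfl⟩ := h
  exact ⟨expand ξ m s, expand ξ m t, by simp⟩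

theorem language_infix {u w : List A} (h : u <:+: w) (hw : w ∈ language ξ) :
    u ∈ language ξ := by
  obtain ⟨n, b, hb⟩ := hw
  exact ⟨n, b, h.trans hb⟩

theorem expand_mem_language (m : ℕ) {w : List A} (hw : w ∈ language ξ) :
    expand ξ m w ∈ language ξ := by
  obtain ⟨n, b, hb⟩ := hw
  exact ⟨n + m, b, by rw [substPow_add]; exact expand_infix m hb⟩

/-- Since no letter has an empty image, lengthening a prefix strictly lengthens its image. A cut of
the expanded word therefore comes from only one prefix. -/
theorem eq_of_prefix_of_length_expand_eq (hne : ∀ b, ξ b ≠ []) (m : ℕ) {u v w : List A}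
    (hu : u <+: w) (hv : v <+: w) (h : (expand ξ m u).length = (expand ξ m v).length) :
    u = v := by
  wlog huv : u.length ≤ v.length generalizing u v
  · exact (this hv hu h.symm (le_of_not_ge huv)).symm
  obtain ⟨t, rfl⟩ := List.prefix_of_prefix_length_le hu hv huv
  rw [expand_append, List.length_append] at h
  have := length_le_length_expand hne m t
  have ht : t = [] := List.length_eq_zero_iff.1 (by omega)
  simp [ht]

end Words

/-! ### Consequences of primitivity -/

section Primitive

variable {A : Type*} [Fintype A] [DecidableEq A] {ξ : A → List A}

theorem count_expand_one (w : List A) (a : A) :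
    (((expand ξ 1 w).count a : ℕ) : ℝ) = ∑ b, incidence ξ a b * ((w.count b : ℕ) : ℝ) := by
  induction w with
  | nil => simp
  | cons c w ih =>
    rw [expand_cons, List.count_append, Nat.cast_add, ih, substPow_one]
    simp only [List.count_cons, Nat.cast_add, mul_add, Finset.sum_add_distrib]
    rw [add_comm]
    congr 1
    simp [incidence]

theorem incidence_pow_apply (k : ℕ) (a b : A) :
    (incidence ξ ^ k) a b = (((substPow ξ k b).count a : ℕ) : ℝ) := by
  induction k generalizing a with
  | zero =>
    rcases eq_or_ne a b with rfl | h
    · simp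
    · simp [h, h.symm]
  | succ k ih =>
    rw [substPow_add, count_expand_one, pow_succ', Matrix.mul_apply]
    simp [ih]

theorem exists_forall_mem_substPow (hprim : (incidence ξ).IsPrimitive) :
    ∃ k, ∀ a b, a ∈ substPow ξ k b := by
  obtain ⟨-, k, -, hk⟩ := hprim
  refine ⟨k, fun a b => ?_⟩
  have := hk a b
  rw [incidence_pow_apply] at this
  exact List.count_pos_iff.1 (by exact_mod_cast this)

theorem exists_forall_ge_mem_substPow (hne : ∀ b, ξ b ≠ []) (hprim : (incidence ξ).IsPrimitive) :
    ∃ k, ∀ m ≥ k, ∀ a b, a ∈ substPow ξ m b := by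
  obtain ⟨k, hk⟩ := exists_forall_mem_substPow hprim
  refine ⟨k, fun m hm a b => ?_⟩
  obtain ⟨j, rfl⟩ := Nat.exists_eq_add_of_le' hm
  rw [substPow_add]
  obtain ⟨c, w, h⟩ := List.exists_cons_of_ne_nil (substPow_ne_nil hne j b)
  rw [h, expand_cons]
  exact List.mem_append_left _ (hk a c)

/-- The bound is uniform in the level: ξ^(j+k)(b) contains ξ^j(a), and ξ^(j+k)(a) is longer than
ξ^j(a) by a bounded factor only. -/
theorem exists_length_le_mul_length (hne : ∀ b, ξ b ≠ []) (hprim : (incidence ξ).IsPrimitive) :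
    ∃ C : ℕ, ∀ m a b, (substPow ξ m a).length ≤ C * (substPow ξ m b).length := by
  obtain ⟨k, hk⟩ := exists_forall_mem_substPow hprim
  obtain ⟨C, hC⟩ : ∃ C : ℕ, ∀ a, (substPow ξ k a).length ≤ C :=
    ⟨∑ a, (substPow ξ k a).length, fun a =>
      Finset.single_le_sum (f := fun a => (substPow ξ k a).length) (fun _ _ => Nat.zero_le _)
        (Finset.mem_univ a)⟩
  refine ⟨C, fun m a b => ?_⟩
  rcases le_total k m with hm | hm
  · obtain ⟨j, rfl⟩ := Nat.exists_eq_add_of_le' hm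
    have h1 : (substPow ξ (j + k) a).length ≤ (substPow ξ j a).length * C := by
      rw [substPow_add]
      exact length_expand_le hC _
    have h2 : (substPow ξ j a).length ≤ (substPow ξ (j + k) b).length := by
      rw [add_comm, substPow_add]
      exact (substPow_infix_expand j (hk a b)).length_le
    calc _ ≤ _ := h1
      _ ≤ (substPow ξ (j + k) b).length * C := Nat.mul_le_mul_right _ h2
      _ = _ := mul_comm _ _
  · obtain ⟨j, rfl⟩ := Nat.exists_eq_add_of_le hm
    have h1 : (substPow ξ m a).length ≤ C := by
      refine le_trans ?_ (hC a)
      rw [substPow_add]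
      exact length_le_length_expand hne _ _
    have := length_substPow_pos hne m b
    nlinarith

end Primitive

/-! ### Tilings of bi-infinite sequences by images of letters -/

section Tilings

variable {A : Type*} {ξ : A → List A}

/-- Translation of a bi-infinite sequence by an integer. -/
def translate (t : ℤ) (x : ℤ → A) : ℤ → A := fun i => x (i + t)

@[simp] theorem translate_apply (t : ℤ) (x : ℤ → A) (i : ℤ) : translate t x i = x (i + t) := rfl

@[simp] theorem translate_zero (x : ℤ → A) : translate 0 x = x := by
  funext i; simp

theorem translate_translate (s t : ℤ) (x : ℤ → A) :
    translate s (translate t x) = translate (s + t) x := by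
  funext i; simp [add_assoc]

theorem shift_iterate (k : ℕ) (x : ℤ → A) : shift^[k] x = translate k x := by
  induction k with
  | zero => simp
  | succ k ih =>
    rw [Function.iterate_succ_apply', ih]
    funext i
    simp [shift, add_comm, add_left_comm]

@[simp] theorem length_factor (x : ℤ → A) (i : ℤ) (n : ℕ) : (factor x i n).length = n := by
  simp [factor]

@[simp] theorem factor_zero (x : ℤ → A) (i : ℤ) : factor x i 0 = [] := by
  simp [factor]

@[simp] theorem factor_one (x : ℤ → A) (i : ℤ) : factor x i 1 = [x i] := by
  simp [factor]

theorem getElem_factor (x : ℤ → A) (i : ℤ) (n k : ℕ) (hk : k < (factor x i n).length) :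
    (factor x i n)[k] = x (i + k) := by
  simp [factor]

theorem factor_add (x : ℤ → A) (i : ℤ) (m n : ℕ) :
    factor x i (m + n) = factor x i m ++ factor x (i + m) n := by
  simp [factor, List.ofFn_add, add_assoc]

theorem factor_infix (x : ℤ → A) {i i' : ℤ} {n n' : ℕ} (h : i ≤ i') (h' : i' + n' ≤ i + n) :
    factor x i' n' <:+: factor x i n := by
  obtain ⟨s, rfl⟩ := Int.le.dest h
  obtain ⟨t, rfl⟩ : ∃ t, n = s + n' + t := ⟨n - (s + n'), by omega⟩
  exact ⟨factor x i s, factor x (i + (s + n' : ℕ)) t, by simp [factor_add, List.append_assoc]⟩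

theorem factor_ext {x y : ℤ → A} {i j : ℤ} {n : ℕ} (h : ∀ k : ℕ, k < n → x (i + k) = y (j + k)) :
    factor x i n = factor y j n := by
  unfold factor
  congr 1
  funext k
  exact h k k.2

theorem eq_of_factor_eq {x y : ℤ → A} {i j : ℤ} {n : ℕ} (h : factor x i n = factor y j n) {k : ℕ}
    (hk : k < n) : x (i + k) = y (j + k) := by
  have h1 := getElem_factor x i n k (by simpa using hk)
  have h2 := getElem_factor y j n k (by simpa using hk)
  rw [← h1, ← h2]
  simp only [h]

theorem eq_factor_of_getElem {x : ℤ → A} {i : ℤ} {w : List A}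
    (h : ∀ (k : ℕ) (hk : k < w.length), x (i + k) = w[k]) : factor x i w.length = w := by
  refine List.ext_getElem (by simp) fun k h1 h2 => ?_
  rw [getElem_factor, h k h2]

theorem factor_translate (t : ℤ) (x : ℤ → A) (i : ℤ) (n : ℕ) :
    factor (translate t x) i n = factor x (i + t) n := by
  refine factor_ext fun k _ => ?_
  simp [add_right_comm]

theorem translate_mem_Omega (t : ℤ) {x : ℤ → A} (hx : x ∈ Omega ξ) : translate t x ∈ Omega ξ := by
  intro i n
  rw [factor_translate]
  exact hx _ _

/-- `x` is the concatenation of the words `τ (y j)`, the `j`-th of them starting at `c j`. -/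
def Tiling (τ : A → List A) (y x : ℤ → A) (c : ℤ → ℤ) : Prop :=
  (∀ j, c (j + 1) = c j + ((τ (y j)).length : ℤ)) ∧
    ∀ (j : ℤ) (k : ℕ) (hk : k < (τ (y j)).length), x (c j + (k : ℤ)) = (τ (y j))[k]

theorem isImage_iff {τ : A → List A} {y x : ℤ → A} :
    IsImage τ y x ↔ ∃ c, c 0 = 0 ∧ Tiling τ y x c := Iff.rfl

theorem Tiling.translate {τ : A → List A} {y x : ℤ → A} {c : ℤ → ℤ} (h : Tiling τ y x c)
    (s t : ℤ) :
    Tiling τ (translate s y) (PrimSubst.translate t x) (fun j => c (j + s) - t) := by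
  constructor
  · intro j
    have := h.1 (j + s)
    simp only [translate_apply]
    rw [add_right_comm, this]
    ring
  · intro j k hk
    refine Eq.trans ?_ (h.2 (j + s) k hk)
    simp only [translate_apply]
    congr 1
    ring

theorem Tiling.strictMono {τ : A → List A} (hτ : ∀ a, 0 < (τ a).length) {y x : ℤ → A} {c : ℤ → ℤ}
    (h : Tiling τ y x c) : StrictMono c :=
  strictMono_int_of_lt_succ fun j => by
    have := h.1 j
    have := hτ (y j)
    omega

theorem exists_le_lt_of_strictMono {c : ℤ → ℤ} (h : StrictMono c) (i : ℤ) :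
    ∃ j, c j ≤ i ∧ i < c (j + 1) := by
  have up : ∀ n : ℕ, c 0 + n ≤ c n := by
    intro n
    induction n with
    | zero => simp
    | succ n ih =>
      have := h (show (n : ℤ) < (n + 1 : ℕ) by push_cast; omega)
      push_cast at this ⊢
      omega
  have down : ∀ n : ℕ, c (-n) ≤ c 0 - n := by
    intro n
    induction n with
    | zero => simp
    | succ n ih =>
      have := h (show (-((n + 1 : ℕ) : ℤ)) < -n by push_cast; omega)
      push_cast at this ⊢
      omega
  obtain ⟨j, hj, hmax⟩ := Int.exists_greatest_of_bdd (P := fun j => c j ≤ i)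
    ⟨(i - c 0).toNat, fun z hz => by
      by_contra hlt
      have h1 := up ((i - c 0).toNat + 1)
      have h2 := h.monotone (show (((i - c 0).toNat + 1 : ℕ) : ℤ) ≤ z by push_cast; omega)
      push_cast at h1 h2
      omega⟩
    ⟨-((c 0 - i).toNat : ℤ), by have := down (c 0 - i).toNat; omega⟩
  refine ⟨j, hj, ?_⟩
  by_contra hlt
  have := hmax (j + 1) (not_lt.1 hlt)
  omega

theorem Tiling.exists_eq {τ : A → List A} (hτ : ∀ a, 0 < (τ a).length) {y x : ℤ → A}
    {c : ℤ → ℤ} (h : Tiling τ y x c) (i : ℤ) :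
    ∃ (j : ℤ) (k : ℕ), k < (τ (y j)).length ∧ i = c j + k := by
  obtain ⟨j, h1, h2⟩ := exists_le_lt_of_strictMono (h.strictMono hτ) i
  rw [h.1 j] at h2
  exact ⟨j, (i - c j).toNat, by omega, by omega⟩

theorem Tiling.factor_one {τ : A → List A} {y x : ℤ → A} {c : ℤ → ℤ} (h : Tiling τ y x c) (j : ℤ) :
    factor x (c j) (τ (y j)).length = τ (y j) :=
  eq_factor_of_getElem (h.2 j)

theorem tiling_iff_factor {τ : A → List A} {y x : ℤ → A} {c : ℤ → ℤ} :
    Tiling τ y x c ↔ ∀ j, c (j + 1) = c j + ((τ (y j)).length : ℤ) ∧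
      factor x (c j) (τ (y j)).length = τ (y j) := by
  refine ⟨fun h j => ⟨h.1 j, h.factor_one j⟩, fun h => ⟨fun j => (h j).1, fun j k hk => ?_⟩⟩
  have := getElem_factor x (c j) (τ (y j)).length k (by simpa using hk)
  rw [← this]
  simp only [(h j).2]

theorem Tiling.apply_add {m : ℕ} {y x : ℤ → A} {c : ℤ → ℤ} (h : Tiling (substPow ξ m) y x c)
    (j : ℤ) (n : ℕ) : c (j + n) = c j + ((expand ξ m (factor y j n)).length : ℤ) := by
  induction n with
  | zero => simp
  | succ n ih =>
    rw [factor_add, PrimSubst.factor_one, expand_append, List.length_append, expand_singleton]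
    push_cast
    rw [← add_assoc, h.1, ih, add_assoc]

theorem Tiling.factor_eq {m : ℕ} {y x : ℤ → A} {c : ℤ → ℤ} (h : Tiling (substPow ξ m) y x c)
    (j : ℤ) (n : ℕ) :
    factor x (c j) (expand ξ m (factor y j n)).length = expand ξ m (factor y j n) := by
  induction n with
  | zero => simp
  | succ n ih =>
    rw [factor_add, PrimSubst.factor_one, expand_append, List.length_append, expand_singleton,
      PrimSubst.factor_add, ih, ← h.apply_add, h.factor_one]

theorem Tiling.comp {m n : ℕ} {z y x : ℤ → A} {c d : ℤ → ℤ} (h : Tiling (substPow ξ m) y x c)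
    (h' : Tiling (substPow ξ n) z y d) : Tiling (substPow ξ (n + m)) z x (c ∘ d) := by
  rw [tiling_iff_factor]
  intro j
  have h1 := h'.factor_one j
  have h2 := h.apply_add (d j) (substPow ξ n (z j)).length
  have h3 := h.factor_eq (d j) (substPow ξ n (z j)).length
  rw [h1] at h2 h3
  rw [substPow_add]
  exact ⟨by simp only [Function.comp_apply]; rw [h'.1, h2], h3⟩

theorem Tiling.ext {τ : A → List A} (hτ : ∀ a, 0 < (τ a).length) {y x x' : ℤ → A} {c : ℤ → ℤ}
    (h : Tiling τ y x c) (h' : Tiling τ y x' c) : x = x' := by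
  funext i
  obtain ⟨j, k, hk, rfl⟩ := h.exists_eq hτ i
  rw [h.2 j k hk, h'.2 j k hk]

theorem Tiling.eq_of_apply_zero {τ : A → List A} {y x x' : ℤ → A} {c c' : ℤ → ℤ}
    (h : Tiling τ y x c) (h' : Tiling τ y x' c') (h0 : c 0 = c' 0) : c = c' := by
  funext j
  induction j using Int.induction_on with
  | zero => exact h0
  | succ n ih => rw [h.1, h'.1, ih]
  | pred n ih =>
    have h1 := h.1 (-n - 1)
    have h2 := h'.1 (-n - 1)
    rw [sub_add_cancel] at h1 h2
    omega

theorem exists_tiling {τ : A → List A} (hτ : ∀ a, 0 < (τ a).length) (y : ℤ → A) :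
    ∃ x c, c 0 = 0 ∧ Tiling τ y x c := by
  let f : ℤ → ℤ := fun j => ((τ (y j)).length : ℤ)
  -- At most one of the two intervals is nonempty, so a single formula gives the cuts on both sides
  -- of 0.
  let c : ℤ → ℤ := fun j => ∑ i ∈ Finset.Ico 0 j, f i - ∑ i ∈ Finset.Ico j 0, f i
  have hc : ∀ j, c (j + 1) = c j + f j := by
    intro j
    rcases le_or_gt 0 j with hj | hj
    · have h1 : Finset.Ico 0 (j + 1) = insert j (Finset.Ico 0 j) := by
        ext i; simp; omega
      have h2 : Finset.Ico (j + 1) 0 = ∅ := Finset.Ico_eq_empty (by omega)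
      have h3 : Finset.Ico j 0 = ∅ := Finset.Ico_eq_empty (by omega)
      simp only [c, h1, h2, h3]
      rw [Finset.sum_insert (by simp)]
      simp [add_comm]
    · have h1 : Finset.Ico j 0 = insert j (Finset.Ico (j + 1) 0) := by
        ext i; simp; omega
      have h2 : Finset.Ico 0 (j + 1) = ∅ := Finset.Ico_eq_empty (by omega)
      have h3 : Finset.Ico 0 j = ∅ := Finset.Ico_eq_empty (by omega)
      simp only [c, h1, h2, h3]
      rw [Finset.sum_insert (by simp)]
      simp
  have hmono : StrictMono c := strictMono_int_of_lt_succ fun j => by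
    have := hc j
    have h2 : 0 < f j := by have := hτ (y j); simp only [f]; omega
    omega
  choose g hg1 hg2 using exists_le_lt_of_strictMono hmono
  have hlt : ∀ i, (i - c (g i)).toNat < (τ (y (g i))).length := by
    intro i
    have h1 := hg1 i
    have h2 := hg2 i
    rw [hc] at h2
    simp only [f] at h2
    omega
  refine ⟨fun i => (τ (y (g i)))[(i - c (g i)).toNat]'(hlt i), c, by simp [c], hc, ?_⟩
  intro j k hk
  have hj : g (c j + k) = j := by
    have h1 := hg1 (c j + k)
    have h2 := hg2 (c j + k)
    have h3 := hc j
    simp only [f] at h3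
    have h4 : g (c j + k) < j + 1 := hmono.lt_iff_lt.1 (by omega)
    have h5 : j < g (c j + k) + 1 := hmono.lt_iff_lt.1 (by omega)
    omega
  simp [hj]

theorem Tiling.mem_Omega (hne : ∀ b, ξ b ≠ []) {m : ℕ} {y x : ℤ → A} {c : ℤ → ℤ}
    (h : Tiling (substPow ξ m) y x c) (hy : y ∈ Omega ξ) : x ∈ Omega ξ := by
  intro i n
  obtain ⟨j, h1, -⟩ := exists_le_lt_of_strictMono (h.strictMono (length_substPow_pos hne m)) i
  obtain ⟨k, -, h2⟩ :=
    exists_le_lt_of_strictMono (h.strictMono (length_substPow_pos hne m)) (max i (i + n))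
  have h3 : j < k + 1 := (h.strictMono (length_substPow_pos hne m)).lt_iff_lt.1 (by omega)
  obtain ⟨l, hl⟩ := Int.le.dest h3.le
  have h4 := h.apply_add j l
  rw [hl] at h4
  refine language_infix (w := expand ξ m (factor y j l)) ?_ (expand_mem_language m (hy j l))
  rw [← h.factor_eq]
  exact factor_infix x h1 (by omega)

end Tilings

/-! ### Existence of preimages in Ω, by compactness -/

section Desubstitution

variable {A : Type*} {ξ : A → List A}

theorem exists_eventually_eq_hyperfilter {B : Type*} [Finite B] (u : ℕ → B) :
    ∃ b, ∀ᶠ N in hyperfilter ℕ, u N = b := by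
  by_contra! hcon
  obtain ⟨N, hN⟩ := (eventually_all.2 hcon).exists
  exact hN _ rfl

/-- Compactness of A^ℤ × B: the limit along a nonprincipal ultrafilter agrees with the sequence on
any finite window for arbitrarily large indices. -/
theorem exists_limit {B : Type*} [Finite A] [Finite B] (f : ℕ → ℤ → A) (g : ℕ → B) :
    ∃ (y : ℤ → A) (b : B), ∀ (s : Finset ℤ) (N₀ : ℕ), ∃ N ≥ N₀, g N = b ∧ ∀ i ∈ s, f N i = y i := by
  choose y hy using fun i => exists_eventually_eq_hyperfilter fun N => f N i
  obtain ⟨b, hb⟩ := exists_eventually_eq_hyperfilter g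
  refine ⟨y, b, fun s N₀ => ?_⟩
  have h1 : ∀ᶠ N in hyperfilter ℕ, ∀ i ∈ s, f N i = y i :=
    (Filter.eventually_all_finset s).2 fun i _ => hy i
  have h2 : ∀ᶠ N in (hyperfilter ℕ : Filter ℕ), N₀ ≤ N := by
    apply Filter.hyperfilter_le_cofinite
    rw [Nat.cofinite_eq_atTop]
    exact eventually_ge_atTop N₀
  obtain ⟨N, hN1, hN2, hN3⟩ := (h1.and (hb.and h2)).exists
  exact ⟨N, hN3, hN2, hN1⟩

theorem Tiling.apply_eq_of_agree {m : ℕ} {y y' x x' : ℤ → A} {c c' : ℤ → ℤ}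
    (h : Tiling (substPow ξ m) y x c) (h' : Tiling (substPow ξ m) y' x' c') (h0 : c 0 = c' 0)
    {R : ℕ} (hR : ∀ j : ℤ, |j| ≤ R → y j = y' j) {j : ℤ} (hj : |j| ≤ R) : c j = c' j := by
  rw [abs_le] at hj
  obtain ⟨n, rfl | rfl⟩ := j.eq_nat_or_neg
  · have h1 := h.apply_add 0 n
    have h2 := h'.apply_add 0 n
    rw [factor_ext (y := y') (j := 0)] at h1
    · simp only [zero_add] at h1 h2
      rw [h1, h2, h0]
    · intro k hk
      exact hR _ (abs_le.2 (by omega))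
  · have h1 := h.apply_add (-n) n
    have h2 := h'.apply_add (-n) n
    rw [factor_ext (y := y') (j := -n)] at h1
    · simp only [neg_add_cancel] at h1 h2
      omega
    · intro k hk
      exact hR _ (abs_le.2 (by omega))

theorem Tiling.add_le (hne : ∀ b, ξ b ≠ []) {m : ℕ} {y x : ℤ → A} {c : ℤ → ℤ}
    (h : Tiling (substPow ξ m) y x c) (j : ℤ) (n : ℕ) : c j + n ≤ c (j + n) := by
  rw [h.apply_add]
  have := length_le_length_expand hne m (factor y j n)
  rw [length_factor] at this
  omega

theorem Tiling.le_add {m L : ℕ} (hL : ∀ a, (substPow ξ m a).length ≤ L) {y x : ℤ → A} {c : ℤ → ℤ}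
    (h : Tiling (substPow ξ m) y x c) (j : ℤ) (n : ℕ) : c (j + n) ≤ c j + n * L := by
  rw [h.apply_add]
  have := length_expand_le hL (factor y j n)
  rw [length_factor] at this
  zify at this
  omega

theorem Tiling.agree (hne : ∀ b, ξ b ≠ []) {m : ℕ} {y y' x x' : ℤ → A} {c c' : ℤ → ℤ}
    (h : Tiling (substPow ξ m) y x c) (h' : Tiling (substPow ξ m) y' x' c') (h0 : c 0 = c' 0)
    {R : ℕ} (hR : ∀ j : ℤ, |j| ≤ R → y j = y' j) {i : ℤ} (hi : |i - c 0| ≤ R) :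
    x i = x' i := by
  obtain ⟨j, l, hl, rfl⟩ := h.exists_eq (length_substPow_pos hne m) i
  have hj : |j| ≤ R := by
    rw [abs_le] at hi ⊢
    constructor
    · by_contra hlt
      obtain ⟨n, hn⟩ := Int.le.dest (show j + 1 ≤ 0 by omega)
      have h1 := h.add_le hne (j + 1) n
      rw [hn, h.1] at h1
      omega
    · by_contra hlt
      obtain ⟨n, hn⟩ := Int.le.dest (show 0 ≤ j by omega)
      have h1 := h.add_le hne 0 n
      rw [hn] at h1
      omega
  have h2 := h.apply_eq_of_agree h' h0 hR hj
  have h3 := hR j hj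
  rw [h.2 j l hl, h2, h'.2 j l (h3 ▸ hl)]
  simp only [h3]

theorem exists_tiling_at {m : ℕ} (hne : ∀ b, ξ b ≠ []) (y : ℤ → A) (t : ℤ) :
    ∃ x c, c 0 = t ∧ Tiling (substPow ξ m) y x c := by
  obtain ⟨x, c, h0, h⟩ := exists_tiling (length_substPow_pos hne m) y
  have h1 := h.translate 0 (-t)
  rw [translate_zero] at h1
  exact ⟨_, _, by simp [h0], h1⟩

theorem exists_length_le [Finite A] (ξ : A → List A) (m : ℕ) :
    ∃ L : ℕ, ∀ a, (substPow ξ m a).length ≤ L := by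
  cases nonempty_fintype A
  exact ⟨∑ a, (substPow ξ m a).length, fun a =>
      Finset.single_le_sum (f := fun a => (substPow ξ m a).length) (fun _ _ => Nat.zero_le _)
        (Finset.mem_univ a)⟩

/-- A central window of `x` lies in some ξ(ξ^m(b)), so `x` can be desubstituted there. The sequence
`y` is ξ^m(b) continued arbitrarily. The last clause records that the tiles covering the window come
from a word of the language, which is what survives in the limit. -/
theorem exists_approx_preimage (hne : ∀ b, ξ b ≠ []) {x : ℤ → A} (hx : x ∈ Omega ξ) (N : ℕ) :
    ∃ (y x' : ℤ → A) (c : ℤ → ℤ) (k : ℕ), Tiling (substPow ξ 1) y x' c ∧ c 0 = -k ∧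
      k < (substPow ξ 1 (y 0)).length ∧ (∀ i : ℤ, |i| ≤ N → x' i = x i) ∧
      ∃ (j : ℤ) (l : ℕ), factor y j l ∈ language ξ ∧ c j ≤ -N ∧ N < c (j + l) := by
  -- The window has length at least 3, so it does not fit into a single letter and the level found
  -- below is positive.
  let M := N + 1
  obtain ⟨m, b, s, t, hst⟩ := hx (-M) (2 * M + 1)
  obtain ⟨m, rfl⟩ : ∃ m', m = m' + 1 := by
    rcases m with _ | m
    · have := congrArg List.length hst
      simp [M] at this
      omega
    · exact ⟨m, rfl⟩
  rw [substPow_add] at hst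
  set w := substPow ξ m b with hw
  let y : ℤ → A := fun i => w.getD i.toNat b
  have hy : factor y 0 w.length = w := by
    refine eq_factor_of_getElem fun k hk => ?_
    simp [y, hk]
  obtain ⟨x', c, h0, h⟩ := exists_tiling_at (m := 1) hne y 0
  have hx' := h.factor_eq 0 w.length
  have hend := h.apply_add 0 w.length
  rw [hy, h0] at hx' hend
  rw [← hst] at hx' hend
  have hagree : ∀ i : ℤ, |i| ≤ M → x' (s.length + M + i) = x i := by
    intro i hi
    rw [abs_le] at hi
    obtain ⟨k, hk⟩ := Int.le.dest hi.1
    have h1 : factor x' s.length (2 * M + 1) = factor x (-M) (2 * M + 1) := by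
      simp only [List.length_append, length_factor, factor_add x' _ (s.length + (2 * M + 1)),
        factor_add x' _ s.length, zero_add] at hx'
      have h2 := (List.append_inj hx' (by simp)).1
      exact (List.append_inj h2 (by simp)).2
    have h2 := eq_of_factor_eq h1 (k := k) (by omega)
    rw [hk] at h2
    rw [← h2]
    congr 1
    omega
  obtain ⟨j₀, k, hk, hjk⟩ := h.exists_eq (length_substPow_pos hne 1) (s.length + M)
  have h' := h.translate j₀ (s.length + M)
  refine ⟨_, _, _, k, h', by simp only [zero_add]; omega, by simpa using hk, ?_, -j₀, w.length,
    ?_, ?_, ?_⟩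
  · intro i hi
    rw [translate_apply, add_comm]
    refine hagree i ?_
    simp only [M]
    push_cast
    omega
  · rw [factor_translate, neg_add_cancel, hy]
    exact ⟨m, b, hw ▸ List.infix_refl _⟩
  · simp [h0, M]
  · have : -j₀ + (w.length : ℤ) + j₀ = 0 + w.length := by ring
    simp only [this, hend, List.length_append, length_factor, M]
    push_cast
    omega

/-- The approximate preimages have offsets below a fixed bound, so a limit with constant offset
exists; its image is `x` since images depend locally on the sequence. -/
theorem exists_preimage [Finite A] (hne : ∀ b, ξ b ≠ []) {x : ℤ → A} (hx : x ∈ Omega ξ) :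
    ∃ y ∈ Omega ξ, ∃ c, Tiling (substPow ξ 1) y x c := by
  obtain ⟨L, hL⟩ := exists_length_le ξ 1
  choose y x' c k ht h0 hk hx' hlang using exists_approx_preimage hne hx
  have hkL : ∀ N, k N < L := fun N => (hk N).trans_le (hL _)
  obtain ⟨z, b, hz⟩ := exists_limit y fun N => (⟨k N, hkL N⟩ : Fin L)
  obtain ⟨x'', d, hd0, hd⟩ := exists_tiling_at (m := 1) hne z (-(b : ℕ))
  have hlim : ∀ R N₀ : ℕ, ∃ N ≥ N₀, c N 0 = d 0 ∧ ∀ j : ℤ, |j| ≤ R → y N j = z j := by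
    intro R N₀
    obtain ⟨N, hN, h1, h2⟩ := hz (Finset.Icc (-R) R) N₀
    refine ⟨N, hN, ?_, fun j hj => h2 j ?_⟩
    · rw [h0, hd0, ← h1]
    · rw [abs_le] at hj
      exact Finset.mem_Icc.2 hj
  have hxx : x'' = x := by
    funext i
    obtain ⟨N, hN, h1, h2⟩ := hlim (|i - d 0|.toNat) |i|.toNat
    rw [← hx' N i (by omega)]
    exact ((ht N).agree hne hd h1 h2 (i := i) (by rw [h1]; omega)).symm
  refine ⟨z, fun i n => ?_, d, hxx ▸ hd⟩
  let R : ℕ := i.natAbs + n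
  -- Tiles with index at most `R` in modulus stay within distance `(R + 1) * L` of 0, hence inside
  -- the window covered by the word of the language.
  obtain ⟨N, hN, h1, h2⟩ := hlim R ((R + 1) * L)
  obtain ⟨j, l, hw, hj, hl⟩ := hlang N
  rw [← factor_ext (x := y N) (i := i) (fun k hk => h2 _ (by simp only [R]; rw [abs_le]; omega))]
  have hb : (b : ℕ) < L := b.2
  have hmono := (ht N).strictMono (length_substPow_pos hne 1)
  have h3 : (R : ℤ) * L + L ≤ N := by
    have : ((R + 1) * L : ℕ) ≤ N := hN
    zify at this
    linarith
  have h4 : (0 : ℤ) ≤ R * L := by positivity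
  refine language_infix (factor_infix (y N) ?_ ?_) hw
  · have h5 : j < -R + 1 := by
      by_contra hlt
      have h6 := hmono.monotone (show -(R : ℤ) ≤ j by omega)
      have h7 := (ht N).le_add hL (-R) R
      rw [neg_add_cancel, h1, hd0] at h7
      have h8 : -(R : ℤ) = j := by
        by_contra hne'
        have := hmono (show -(R : ℤ) < j by omega)
        omega
      omega
    simp only [R] at h5
    omega
  · have h5 : (R : ℤ) ≤ j + l := by
      by_contra hlt
      have h6 := hmono (show j + l < R by omega)
      have h7 := (ht N).le_add hL 0 R
      rw [zero_add, h1, hd0] at h7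
      omega
    simp only [R] at h5
    omega

theorem exists_preimage_pow [Finite A] (hne : ∀ b, ξ b ≠ []) (m : ℕ) {x : ℤ → A}
    (hx : x ∈ Omega ξ) : ∃ y ∈ Omega ξ, ∃ c, Tiling (substPow ξ m) y x c := by
  induction m with
  | zero =>
    refine ⟨x, hx, fun j => j, ?_, ?_⟩
    · simp
    · intro j k hk
      simp at hk
      subst hk
      simp
  | succ m ih =>
    obtain ⟨y, hy, c, hc⟩ := ih
    obtain ⟨z, hz, d, hd⟩ := exists_preimage hne hy
    refine ⟨z, hz, c ∘ d, ?_⟩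
    rw [add_comm]
    exact hc.comp hd

theorem Tiling.center (hne : ∀ b, ξ b ≠ []) {m : ℕ} {y x : ℤ → A} {c : ℤ → ℤ}
    (h : Tiling (substPow ξ m) y x c) (i : ℤ) :
    ∃ (s : ℤ) (k : ℕ), k < (substPow ξ m (PrimSubst.translate s y 0)).length ∧
      Tiling (substPow ξ m) (PrimSubst.translate s y) x (fun j => c (j + s)) ∧ c s = i - k := by
  obtain ⟨s, k, hk, hi⟩ := h.exists_eq (length_substPow_pos hne m) i
  refine ⟨s, k, by simpa using hk, ?_, by omega⟩
  have := h.translate s 0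
  simpa using this

end Desubstitution

/-! ### Recognizability: uniqueness of the desubstitution -/

section Recognizability

variable {A : Type*} {ξ : A → List A}

theorem getElem?_append_middle (s t : List A) {w : List A} {i : ℕ} (h : i < w.length) :
    (s ++ w ++ t)[s.length + i]? = w[i]? := by
  rw [List.append_assoc, List.getElem?_append_right (by omega), Nat.add_sub_cancel_left,
    List.getElem?_append_left h]

/-- Two shifted occurrences of ξ^M(v) in one word give it a period no longer than any tile of level
M. As `v` contains all two-letter factors, a coordinate of any point of Ω and its translate by the
period lie in a common factor of ξ^M(v). -/
theorem exists_period_of_overlap [Finite A] (hne : ∀ b, ξ b ≠ []) {M : ℕ} {v P P' Q Q' : List A}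
    (hv : ∀ x ∈ Omega ξ, ∀ i, factor x i 2 <:+: v)
    (h : P ++ expand ξ M v ++ Q = P' ++ expand ξ M v ++ Q') (h1 : P.length < P'.length)
    (h2 : ∀ a, P'.length ≤ P.length + (substPow ξ M a).length) :
    ∃ d : ℕ, 0 < d ∧ ∀ x ∈ Omega ξ, ∀ i : ℤ, x (i + d) = x i := by
  obtain ⟨d, hd⟩ := Nat.exists_eq_add_of_lt h1
  refine ⟨d + 1, by omega, fun x hx i => ?_⟩
  obtain ⟨z, hz, c, hc⟩ := exists_preimage_pow hne M hx
  obtain ⟨j, l, hl, rfl⟩ := hc.exists_eq (length_substPow_pos hne M) i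
  have hf := hc.factor_eq j 2
  obtain ⟨s, t, hst⟩ := expand_infix M (hv z hz j)
  rw [← hf] at hst
  have hlen : l + (d + 1) < (expand ξ M (factor z j 2)).length := by
    have := h2 (z (j + 1))
    rw [factor_add z j 1 1, factor_one, factor_one, expand_append, List.length_append,
      expand_singleton, expand_singleton]
    push_cast
    omega
  set n := (expand ξ M (factor z j 2)).length with hn
  have key : ∀ i, i + (d + 1) < (expand ξ M v).length →
      (expand ξ M v)[i + (d + 1)]? = (expand ξ M v)[i]? := fun i hi => by
    rw [← getElem?_append_middle P Q hi, ← getElem?_append_middle P' Q' (show i < _ by omega), h]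
    congr 1
    omega
  have hlen' := congrArg List.length hst
  simp only [List.length_append, length_factor] at hlen'
  have e1 := key (s.length + l) (by omega)
  rw [← hst, add_assoc, getElem?_append_middle s t (by rw [length_factor]; omega),
    getElem?_append_middle s t (by rw [length_factor]; omega),
    List.getElem?_eq_getElem (by rw [length_factor]; omega),
    List.getElem?_eq_getElem (by rw [length_factor]; omega), getElem_factor, getElem_factor,
    Option.some_inj] at e1
  rw [← e1]
  congr 1
  push_cast
  ring

theorem Tiling.split (hne : ∀ b, ξ b ≠ []) {m n : ℕ} {z x : ℤ → A} {c : ℤ → ℤ}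
    (h : Tiling (substPow ξ (n + m)) z x c) :
    ∃ y d e, Tiling (substPow ξ m) y x e ∧ Tiling (substPow ξ n) z y d ∧ c = e ∘ d := by
  obtain ⟨y, d, hd0, hd⟩ := exists_tiling_at (m := n) hne z 0
  obtain ⟨x', e, he0, he⟩ := exists_tiling_at (m := m) hne y (c 0)
  have hcomp := he.comp hd
  have hce : c = e ∘ d := h.eq_of_apply_zero hcomp (by simp [hd0, he0])
  have hx : x = x' := h.ext (length_substPow_pos hne _) (hce ▸ hcomp)
  exact ⟨y, d, e, hx ▸ he, hd, hce⟩

variable [Fintype A] [DecidableEq A]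

/-- By primitivity one level N works for all finitely many two-letter words: each occurs in every
ξ^N(e). A window long enough to contain a whole tile of level N then contains them all. -/
theorem exists_window (hne : ∀ b, ξ b ≠ []) (hprim : (incidence ξ).IsPrimitive) :
    ∃ K : ℕ, 0 < K ∧ ∀ x ∈ Omega ξ, ∀ y ∈ Omega ξ, ∀ i j, factor x i 2 <:+: factor y j K := by
  obtain ⟨k, hk⟩ := exists_forall_ge_mem_substPow hne hprim
  have h : ∀ p : A × A, ∀ᶠ N in atTop, [p.1, p.2] ∈ language ξ →
      ∀ e, [p.1, p.2] <:+: substPow ξ N e := by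
    intro p
    by_cases hp : [p.1, p.2] ∈ language ξ
    · obtain ⟨n, b, hb⟩ := hp
      filter_upwards [eventually_ge_atTop (n + k)] with N hN _ e
      obtain ⟨m, rfl⟩ := Nat.exists_eq_add_of_le hN
      rw [show n + k + m = (k + m) + n by ring, substPow_add]
      exact hb.trans (substPow_infix_expand n (hk (k + m) (by omega) b e))
    · exact Eventually.of_forall fun N h => absurd h hp
  obtain ⟨N, hN⟩ := (eventually_all.2 h).exists
  obtain ⟨L, hL⟩ := exists_length_le ξ N
  refine ⟨2 * L + 1, by omega, fun x hx y hy i j => ?_⟩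
  obtain ⟨z, hz, c, hc⟩ := exists_preimage_pow hne N hy
  obtain ⟨s, l, hl, rfl⟩ := hc.exists_eq (length_substPow_pos hne N) j
  have e : factor x i 2 = [x i, x (i + 1)] := by
    rw [factor_add x i 1 1, factor_one, factor_one]; rfl
  have h1 := hN (x i, x (i + 1)) (e ▸ hx i 2) (z (s + 1))
  rw [e]
  refine h1.trans ?_
  have h2 := hL (z s)
  have h3 := hL (z (s + 1))
  have h4 := hc.factor_one (s + 1)
  rw [← h4]
  refine factor_infix y ?_ ?_
  · rw [hc.1]; omega
  · rw [hc.1]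
    push_cast
    omega

/-- Two desubstitutions of one point are compared at level n+1: around position `j`, the word
ξ^(n+1)(v) read through `y` lies in ξ^(n+1)(v') read through `y'`, at offset |P|. The essential
point is that `K`, `K'` and `C` do not depend on n, so only finitely many pairs `(v, v')` occur. -/
theorem exists_common_window (hne : ∀ b, ξ b ≠ []) (hprim : (incidence ξ).IsPrimitive) :
    ∃ K K' C : ℕ, ∀ {x y y' : ℤ → A} {c c' : ℤ → ℤ}, y ∈ Omega ξ → y' ∈ Omega ξ →
      Tiling (substPow ξ 1) y x c → Tiling (substPow ξ 1) y' x c' → ∀ (j : ℤ) (n : ℕ),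
      ∃ (v : List.Vector A K) (v' : List.Vector A K') (P Q : List A) (t t' : ℤ),
        (∀ x ∈ Omega ξ, ∀ i, factor x i 2 <:+: v.1) ∧
        factor y t (expand ξ n v.1).length = expand ξ n v.1 ∧
        t ≤ j ∧ j < t + (expand ξ n v.1).length ∧
        factor y' t' (expand ξ n v'.1).length = expand ξ n v'.1 ∧
        expand ξ (n + 1) v'.1 = P ++ expand ξ (n + 1) v.1 ++ Q ∧
        c t = c' t' + P.length ∧
        ∀ e a, (expand ξ e P).length ≤ C * (substPow ξ (n + 1 + e) a).length := by
  obtain ⟨K, hK0, hK⟩ := exists_window hne hprim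
  obtain ⟨C, hC⟩ := exists_length_le_mul_length hne hprim
  -- One tile contains the starting point, and `K * C` further tiles are at least as long as any `K`
  -- tiles.
  refine ⟨K, 1 + K * C, C, fun {x y y' c c'} hy hy' hc hc' j n => ?_⟩
  obtain ⟨z, hz, d, hd⟩ := exists_preimage_pow hne n hy
  obtain ⟨z', hz', d', hd'⟩ := exists_preimage_pow hne n hy'
  have hcd := hc.comp hd
  have hcd' := hc'.comp hd'
  obtain ⟨s, l, hl, rfl⟩ := hd.exists_eq (length_substPow_pos hne n) j
  obtain ⟨s', l', hl', hs'⟩ := hcd'.exists_eq (length_substPow_pos hne (n + 1)) (c (d s))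
  have hw := hcd.factor_eq s K
  have hw' := hcd'.factor_eq s' (1 + K * C)
  simp only [Function.comp_apply] at hw hw' hs'
  set w := expand ξ (n + 1) (factor z s K) with hwdef
  set w' := expand ξ (n + 1) (factor z' s' (1 + K * C)) with hwdef'
  have hlen : l' + w.length ≤ w'.length := by
    obtain ⟨b, hb⟩ : ∃ b, ∀ a, (substPow ξ (n + 1) b).length ≤ (substPow ξ (n + 1) a).length :=
      haveI : Nonempty A := ⟨z s⟩
      Finite.exists_min fun a => (substPow ξ (n + 1) a).length
    have h1 : w.length ≤ K * (C * (substPow ξ (n + 1) b).length) := by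
      have := length_expand_le (fun a => hC (n + 1) a b) (factor z s K)
      rwa [length_factor] at this
    have h2 : K * C * (substPow ξ (n + 1) b).length ≤
        (expand ξ (n + 1) (factor z' (s' + (1 : ℕ)) (K * C))).length := by
      have := le_length_expand hb (factor z' (s' + (1 : ℕ)) (K * C))
      rwa [length_factor] at this
    rw [hwdef', factor_add, PrimSubst.factor_one, expand_append, List.length_append,
      expand_singleton]
    rw [mul_assoc] at h2
    omega
  obtain ⟨r, hr⟩ := Nat.exists_eq_add_of_le hlen
  have hsplit : w' = factor x (c' (d' s')) l' ++ w ++ factor x (c' (d' s') + (l' + w.length : ℕ)) r := by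
    rw [← hw', hr, factor_add x _ (l' + w.length), factor_add x _ l', ← hs', hw]
  have hfac := hd.factor_eq s K
  have hfac' := hd'.factor_eq s' (1 + K * C)
  refine ⟨⟨factor z s K, length_factor ..⟩, ⟨factor z' s' (1 + K * C), length_factor ..⟩, _, _,
    d s, d' s', fun x hx i => hK x hx z hz i s, hfac, by omega, ?_, hfac', hsplit, ?_, ?_⟩
  · have : K = 1 + (K - 1) := by omega
    simp only
    rw [this, factor_add, PrimSubst.factor_one, expand_append, List.length_append,
      expand_singleton]
    push_cast
    omega
  · rw [hs', length_factor]
  · intro e a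
    have h1 : factor x (c' (d' s')) l' <+: substPow ξ (n + 1) (z' s') := by
      have := hcd'.factor_one s'
      simp only [Function.comp_apply] at this
      rw [← this]
      obtain ⟨q, hq⟩ := Nat.exists_eq_add_of_lt hl'
      rw [hq, add_assoc, factor_add]
      exact List.prefix_append _ _
    refine le_trans ?_ (hC _ (z' s') a)
    rw [substPow_add]
    exact (expand_infix e h1.isInfix).length_le

/-- Mossé's argument. Infinitely many levels share the same pair of words. Pushed to a common level,
they give occurrences of one word in another; two of these at distinct but close offsets would
produce a period. So two offsets coincide, and then the offset word at the higher level is itself an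
image under ξ, which makes the cut of `y` a cut of `y'`. -/
theorem exists_tile_eq (hne : ∀ b, ξ b ≠ []) (hprim : (incidence ξ).IsPrimitive)
    (hap : ¬ ∃ d : ℕ, 0 < d ∧ ∀ x ∈ Omega ξ, ∀ i : ℤ, x (i + d) = x i)
    {x y y' : ℤ → A} {c c' : ℤ → ℤ} (hy : y ∈ Omega ξ) (hy' : y' ∈ Omega ξ)
    (hc : Tiling (substPow ξ 1) y x c) (hc' : Tiling (substPow ξ 1) y' x c') (j : ℤ) :
    ∃ j', c' j' = c j ∧ y' j' = y j := by
  obtain ⟨K, K', C, H⟩ := exists_common_window hne hprim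
  choose v v' P Q t t' hv hfac htj hjt hfac' hsplit hct hP using H hy hy' hc hc' j
  obtain ⟨⟨u, u'⟩, hfib⟩ := Finite.exists_infinite_fiber fun n => (v n, v' n)
  -- In units of the shortest tile of level `M` the offsets have integer part at most `C`; `C + 2`
  -- levels therefore yield two in the same unit.
  obtain ⟨T, hT, hcard⟩ := (Set.infinite_coe_iff.1 hfib).exists_subset_card_eq (C + 2)
  have hTu : ∀ n ∈ T, v n = u ∧ v' n = u' := fun n hn => by
    have := hT hn
    simpa using this
  let M := T.sup id + 1
  have hM : ∀ n ∈ T, n + 1 ≤ M := fun n hn =>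
    Nat.succ_le_succ (Finset.le_sup (f := id) hn)
  have : Nonempty A := ⟨y 0⟩
  obtain ⟨b, hb⟩ := Finite.exists_min fun a => (substPow ξ M a).length
  set l := (substPow ξ M b).length with hl
  have hlpos : 0 < l := length_substPow_pos hne M b
  let p : ℕ → ℕ := fun n => (expand ξ (M - (n + 1)) (P n)).length
  have hmaps : ∀ n ∈ T, p n / l ∈ Finset.range (C + 1) := by
    intro n hn
    have h1 := hP n (M - (n + 1)) b
    rw [show n + 1 + (M - (n + 1)) = M by have := hM n hn; omega] at h1
    rw [Finset.mem_range, Nat.lt_succ_iff]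
    exact Nat.div_le_of_le_mul (by rw [mul_comm]; exact h1)
  obtain ⟨n, hn, n', hn', hnn, hpp⟩ : ∃ n ∈ T, ∃ n' ∈ T, n < n' ∧ p n / l = p n' / l := by
    obtain ⟨n, hn, n', hn', h1, h2⟩ := Finset.exists_ne_map_eq_of_card_lt_of_maps_to
      (by rw [hcard, Finset.card_range]; omega) hmaps
    rcases lt_or_gt_of_ne h1 with h3 | h3
    · exact ⟨n, hn, n', hn', h3, h2⟩
    · exact ⟨n', hn', n, hn, h3, h2.symm⟩
  have hocc : ∀ n ∈ T, expand ξ M u'.1 =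
      expand ξ (M - (n + 1)) (P n) ++ expand ξ M u.1 ++ expand ξ (M - (n + 1)) (Q n) := by
    intro n hn
    have h1 := congrArg (expand ξ (M - (n + 1))) (hsplit n)
    rw [expand_append, expand_append, expand_expand, expand_expand, (hTu n hn).1,
      (hTu n hn).2, show n + 1 + (M - (n + 1)) = M by have := hM n hn; omega] at h1
    exact h1
  have hu2 : ∀ x ∈ Omega ξ, ∀ i, factor x i 2 <:+: u.1 := (hTu n hn).1 ▸ hv n
  have hdiv1 := Nat.div_add_mod (p n) l
  have hdiv2 := Nat.div_add_mod (p n') l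
  have hm1 := Nat.mod_lt (p n) hlpos
  have hm2 := Nat.mod_lt (p n') hlpos
  rw [hpp] at hdiv1
  have heq : p n = p n' := by
    by_contra hne'
    rcases lt_or_gt_of_ne hne' with h3 | h3
    · exact hap (exists_period_of_overlap hne hu2 ((hocc n hn).symm.trans (hocc n' hn')) h3
        fun a => by have := hb a; simp only [p] at *; omega)
    · exact hap (exists_period_of_overlap hne hu2 ((hocc n' hn').symm.trans (hocc n hn)) h3
        fun a => by have := hb a; simp only [p] at *; omega)
  obtain ⟨e, rfl⟩ := Nat.exists_eq_add_of_lt hnn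
  -- Both words are prefixes of the same word and have images of equal length at level `M`.
  have hPP : expand ξ (e + 1) (P n) = P (n + e + 1) := by
    have hM' := hM _ hn'
    refine eq_of_prefix_of_length_expand_eq hne (M - (n + e + 1 + 1))
      (w := expand ξ (n + e + 1 + 1) u'.1) ?_ ?_ ?_
    · have h1 := congrArg (expand ξ (e + 1)) (hsplit n)
      rw [expand_append, expand_append, expand_expand, (hTu n hn).2, List.append_assoc,
        show n + 1 + (e + 1) = n + e + 1 + 1 by ring] at h1
      rw [h1]
      exact List.prefix_append _ _
    · rw [← (hTu _ hn').2, hsplit, List.append_assoc]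
      exact List.prefix_append _ _
    · rw [expand_expand]
      simp only [p] at heq
      rw [← heq]
      congr 2
      omega
  set N := n + e + 1 with hN
  set R := expand ξ e (P n) with hR
  have hR1 : expand ξ 1 R = P N := by rw [hR, expand_expand, hPP]
  have hword : expand ξ N u'.1 = R ++ expand ξ N u.1 ++ expand ξ e (Q n) := by
    have h1 := congrArg (expand ξ e) (hsplit n)
    rw [expand_append, expand_append, expand_expand, expand_expand, (hTu n hn).1,
      (hTu n hn).2, show n + 1 + e = N by omega] at h1
    exact h1
  have hf' := hfac' N
  have hf := hfac N
  have hj1 := htj N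
  have hj2 := hjt N
  have hctN := hct N
  rw [(hTu N hn').2, hword, List.length_append, List.length_append, factor_add, factor_add] at hf'
  rw [(hTu N hn').1] at hf hj2
  have hf1 := (List.append_inj hf' (by simp)).1
  have hf2 := (List.append_inj hf1 (by simp)).1
  have hf3 := (List.append_inj hf1 (by simp)).2
  have hyy := hf3.trans hf.symm
  have hcut : c' (t' N + R.length) = c (t N) := by
    rw [hc'.apply_add, hf2, hR1, hctN]
  obtain ⟨i, rfl⟩ := Int.le.dest hj1
  have hi : i < (expand ξ N u.1).length := by omega
  refine ⟨t' N + R.length + i, ?_, eq_of_factor_eq hyy hi⟩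
  rw [hc'.apply_add, hc.apply_add, hcut,
    factor_ext (y := y) fun k hk => eq_of_factor_eq hyy (hk.trans hi)]

/-- Matching tiles have equal letters, hence equal lengths, so the matching of indices commutes with
the successor and is a translation. -/
theorem Tiling.unique_one (hne : ∀ b, ξ b ≠ []) (hprim : (incidence ξ).IsPrimitive)
    (hap : ¬ ∃ d : ℕ, 0 < d ∧ ∀ x ∈ Omega ξ, ∀ i : ℤ, x (i + d) = x i)
    {x y y' : ℤ → A} {c c' : ℤ → ℤ} (hy : y ∈ Omega ξ) (hy' : y' ∈ Omega ξ)
    (hc : Tiling (substPow ξ 1) y x c) (hc' : Tiling (substPow ξ 1) y' x c') :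
    ∃ s, ∀ j, c' (j + s) = c j ∧ y' (j + s) = y j := by
  choose f hf1 hf2 using exists_tile_eq hne hprim hap hy hy' hc hc'
  have hf : ∀ j, f (j + 1) = f j + 1 := fun j => by
    apply (hc'.strictMono (length_substPow_pos hne 1)).injective
    rw [hf1, hc'.1, hf1, hf2, hc.1]
  have h : ∀ j, f j = j + f 0 := by
    intro j
    induction j using Int.induction_on with
    | zero => simp
    | succ n ih => rw [hf, ih]; ring
    | pred n ih =>
      have := hf (-n - 1)
      rw [sub_add_cancel] at this
      omega
  exact ⟨f 0, fun j => by rw [← h]; exact ⟨hf1 j, hf2 j⟩⟩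

theorem Tiling.unique (hne : ∀ b, ξ b ≠ []) (hprim : (incidence ξ).IsPrimitive)
    (hap : ¬ ∃ d : ℕ, 0 < d ∧ ∀ x ∈ Omega ξ, ∀ i : ℤ, x (i + d) = x i)
    {m : ℕ} {x z z' : ℤ → A} {c c' : ℤ → ℤ} (hz : z ∈ Omega ξ) (hz' : z' ∈ Omega ξ)
    (hc : Tiling (substPow ξ m) z x c) (hc' : Tiling (substPow ξ m) z' x c') :
    ∃ s, ∀ j, c' (j + s) = c j ∧ z' (j + s) = z j := by
  induction m generalizing x z z' c c' with
  | zero =>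
    have e : ∀ {z : ℤ → A} {c : ℤ → ℤ}, Tiling (substPow ξ 0) z x c →
        ∀ j, c j = j + c 0 ∧ x (j + c 0) = z j := by
      intro z c h
      have h1 : ∀ j, c j = j + c 0 := by
        intro j
        induction j using Int.induction_on with
        | zero => simp
        | succ n ih => rw [h.1, ih]; simp; ring
        | pred n ih =>
          have := h.1 (-n - 1)
          simp only [sub_add_cancel, substPow_zero, List.length_singleton] at this
          omega
      refine fun j => ⟨h1 j, ?_⟩
      rw [← h1]
      simpa using h.2 j 0 (by simp)
    refine ⟨c 0 - c' 0, fun j => ?_⟩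
    have h1 := e hc j
    have h2 := e hc' (j + (c 0 - c' 0))
    refine ⟨by omega, ?_⟩
    rw [← h1.2, ← h2.2]
    congr 1
    ring
  | succ m ih =>
    obtain ⟨y, d, e, he, hd, rfl⟩ := hc.split hne
    obtain ⟨y', d', e', he', hd', rfl⟩ := hc'.split hne
    obtain ⟨s, hs⟩ := Tiling.unique_one hne hprim hap (hd.mem_Omega hne hz)
      (hd'.mem_Omega hne hz') he he'
    have hy : PrimSubst.translate s y' = y := by
      funext j
      exact (hs j).2
    have h1 := hd'.translate 0 s
    rw [translate_zero, hy] at h1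
    obtain ⟨r, hr⟩ := ih hz hz' hd h1
    refine ⟨r, fun j => ⟨?_, (hr j).2⟩⟩
    have h2 := (hr j).1
    simp only [add_zero] at h2
    simp only [Function.comp_apply]
    rw [← (hs (d j)).1]
    congr 1
    omega

/-- Every point of the subshift has exactly one decomposition into the words `ξ ^ m (b)`. -/
structure Recognizable {A : Type*} (ξ : A → List A) : Prop where
  ne_nil : ∀ b, ξ b ≠ []
  exists_tiling : ∀ (m : ℕ) {x : ℤ → A}, x ∈ Omega ξ →
    ∃ y ∈ Omega ξ, ∃ c, Tiling (substPow ξ m) y x c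
  unique : ∀ {m : ℕ} {x z z' : ℤ → A} {c c' : ℤ → ℤ}, z ∈ Omega ξ → z' ∈ Omega ξ →
    Tiling (substPow ξ m) z x c → Tiling (substPow ξ m) z' x c' →
      ∃ s, ∀ j, c' (j + s) = c j ∧ z' (j + s) = z j

theorem recognizable (hne : ∀ b, ξ b ≠ []) (hprim : (incidence ξ).IsPrimitive)
    (hap : ¬ ∃ d : ℕ, 0 < d ∧ ∀ x ∈ Omega ξ, ∀ i : ℤ, x (i + d) = x i) : Recognizable ξ :=
  ⟨hne, fun m _ hx => exists_preimage_pow hne m hx, fun hz hz' hc hc' =>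
    Tiling.unique hne hprim hap hz hz' hc hc'⟩

end Recognizability

/-! ### Entrance times and visits read off a tiling -/

section Entrance

variable {A : Type*} {ξ : A → List A}

theorem Recognizable.length_pos (h : Recognizable ξ) (m : ℕ) (b : A) :
    0 < (substPow ξ m b).length := length_substPow_pos h.ne_nil m b

/-- Recognizability enters here: the tiling witnessing membership must be the given one up to
reindexing, so visits to the base are exactly the cuts. -/
theorem Recognizable.shift_mem_imagePow_cyl (h : Recognizable ξ) {m : ℕ} {x y : ℤ → A} {c : ℤ → ℤ}
    (hy : y ∈ Omega ξ) (hc : Tiling (substPow ξ m) y x c) (i : ℕ) (a : A) :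
    shift^[i] x ∈ imagePow ξ m (cyl ξ a) ↔ ∃ j, c j = i ∧ y j = a := by
  rw [shift_iterate]
  constructor
  · rintro ⟨z, ⟨hz, hza⟩, d, hd0, hd⟩
    have h1 := hc.translate 0 i
    rw [translate_zero] at h1
    obtain ⟨s, hs⟩ := h.unique hz hy hd h1
    have h2 := hs 0
    rw [hd0, zero_add, add_zero] at h2
    exact ⟨s, by omega, by rw [h2.2, hza]⟩
  · rintro ⟨j, hj, hja⟩
    refine ⟨translate j y, ⟨translate_mem_Omega _ hy, by simpa using hja⟩,
      isImage_iff.2 ⟨_, ?_, hc.translate j i⟩⟩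
    simp [hj]

theorem Recognizable.shift_mem_imagePow (h : Recognizable ξ) {m : ℕ} {x y : ℤ → A} {c : ℤ → ℤ}
    (hy : y ∈ Omega ξ) (hc : Tiling (substPow ξ m) y x c) (i : ℕ) :
    shift^[i] x ∈ imagePow ξ m (Omega ξ) ↔ ∃ j, c j = i := by
  constructor
  · rintro ⟨z, hz, hd⟩
    obtain ⟨j, hj, -⟩ := (h.shift_mem_imagePow_cyl hy hc i (z 0)).1 ⟨z, ⟨hz, rfl⟩, hd⟩
    exact ⟨j, hj⟩
  · rintro ⟨j, hj⟩
    obtain ⟨z, hz, hd⟩ := (h.shift_mem_imagePow_cyl hy hc i (y j)).2 ⟨j, hj, rfl⟩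
    exact ⟨z, hz.1, hd⟩

theorem Recognizable.entrance_eq (h : Recognizable ξ) {m : ℕ} {x y : ℤ → A} {c : ℤ → ℤ}
    (hy : y ∈ Omega ξ) (hc : Tiling (substPow ξ m) y x c) {k : ℕ} (h0 : c 0 = k)
    (h1 : c (-1) < 0) : entrance ξ m x = k := by
  have hmono := hc.strictMono (h.length_pos m)
  refine le_antisymm (Nat.sInf_le ((h.shift_mem_imagePow hy hc k).2 ⟨0, h0⟩)) ?_
  refine le_csInf ⟨k, (h.shift_mem_imagePow hy hc k).2 ⟨0, h0⟩⟩ fun i hi => ?_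
  obtain ⟨j, hj⟩ := (h.shift_mem_imagePow hy hc i).1 hi
  have : -1 < j := hmono.lt_iff_lt.1 (by omega)
  have := hmono.monotone (show 0 ≤ j by omega)
  omega

theorem Recognizable.exists_entrance_tiling (h : Recognizable ξ) (m : ℕ) {x : ℤ → A}
    (hx : x ∈ Omega ξ) : ∃ y ∈ Omega ξ, ∃ c, Tiling (substPow ξ m) y x c ∧
      c 0 = entrance ξ m x ∧ c (-1) < 0 := by
  obtain ⟨y, hy, c, hc⟩ := h.exists_tiling m hx
  obtain ⟨s, h1, h2⟩ := exists_le_lt_of_strictMono (hc.strictMono (h.length_pos m)) (-1)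
  have h3 := hc.translate (s + 1) 0
  rw [translate_zero] at h3
  have hy' := translate_mem_Omega (ξ := ξ) (s + 1) hy
  have e0 : c (0 + (s + 1)) - 0 = (c (s + 1)).toNat := by
    rw [zero_add]; omega
  have e1 : c (-1 + (s + 1)) - 0 < 0 := by
    rw [show -1 + (s + 1) = s by ring]; omega
  exact ⟨_, hy', _, h3, by rw [h.entrance_eq hy' h3 e0 e1, e0], e1⟩

/-- The cuts of level n+m of `x` are the level m cuts located at the level n cuts of the
desubstituted point. -/
theorem Recognizable.entrance_add (h : Recognizable ξ) {m n : ℕ} {x y : ℤ → A} {c : ℤ → ℤ}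
    (hy : y ∈ Omega ξ) (hc : Tiling (substPow ξ m) y x c) (h0 : 0 ≤ c 0) (h1 : c (-1) < 0) :
    (entrance ξ (n + m) x : ℤ) = c (entrance ξ n y) := by
  obtain ⟨z, hz, d, hd, hd0, hd1⟩ := h.exists_entrance_tiling n hy
  have hmono := (hc.strictMono (h.length_pos m)).monotone
  have h2 := hmono (show (0 : ℤ) ≤ entrance ξ n y by omega)
  have h3 := hmono (show d (-1) ≤ -1 by omega)
  rw [h.entrance_eq (k := (c (entrance ξ n y)).toNat) hz (hc.comp hd)]
  · omega
  · simp only [Function.comp_apply, hd0]; omega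
  · simp only [Function.comp_apply]; omega

/-- Under the cut map, visits between two successive entrances correspond to the letters of `y`
before its own first entrance in ξ(Ω). -/
theorem Recognizable.visits_eq [DecidableEq A] (h : Recognizable ξ) {m : ℕ} {x y : ℤ → A}
    {c : ℤ → ℤ} (hy : y ∈ Omega ξ) (hc : Tiling (substPow ξ m) y x c) (h0 : c 0 = entrance ξ m x)
    (h1 : c (-1) < 0) (a : A) :
    visits ξ m x a = ((Finset.range (entrance ξ 1 y)).filter fun j : ℕ => y j = a).card := by
  have hmono := hc.strictMono (h.length_pos m)
  have hent := h.entrance_add (n := 1) hy hc (by omega) h1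
  rw [← Set.ncard_coe_finset]
  symm
  have hnn : ∀ j : ℕ, 0 ≤ c j := fun j => by
    have := hmono.monotone (show (0 : ℤ) ≤ j by omega)
    omega
  refine Set.ncard_congr (fun j _ => (c j).toNat) ?_ ?_ ?_
  · intro j hj
    simp only [Finset.coe_filter, Finset.mem_range, Set.mem_ofPred_eq] at hj
    have h2 := hmono.monotone (show (0 : ℤ) ≤ j by omega)
    have h3 := hmono (show (j : ℤ) < entrance ξ 1 y by omega)
    refine ⟨by omega, by rw [add_comm m 1]; omega, ?_⟩
    exact (h.shift_mem_imagePow_cyl hy hc _ a).2 ⟨j, by have := hnn j; omega, hj.2⟩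
  · intro j k _ _ hjk
    have h2 := hnn j
    have h3 := hnn k
    have : (j : ℤ) = k := hmono.injective (by omega)
    exact_mod_cast this
  · rintro i ⟨h2, h3, h4⟩
    obtain ⟨j, hj, hja⟩ := (h.shift_mem_imagePow_cyl hy hc i a).1 h4
    have h5 : -1 < j := hmono.lt_iff_lt.1 (by omega)
    rw [add_comm m 1] at h3
    have h6 : j < entrance ξ 1 y := hmono.lt_iff_lt.1 (by omega)
    refine ⟨j.toNat, ?_, ?_⟩
    · simp only [Finset.coe_filter, Finset.mem_range, Set.mem_ofPred_eq]
      exact ⟨by omega, by rw [Int.toNat_of_nonneg (by omega)]; exact hja⟩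
    · rw [Int.toNat_of_nonneg (by omega), hj]
      simp

theorem Recognizable.entrance_one_le (h : Recognizable ξ) {m L : ℕ}
    (hL : ∀ a, (substPow ξ m a).length ≤ L) {x : ℤ → A} (hx : x ∈ Omega ξ) :
    entrance ξ m x ≤ L := by
  obtain ⟨y, hy, c, hc, h0, h1⟩ := h.exists_entrance_tiling m hx
  have h2 := hc.1 (-1)
  have h3 := hL (y (-1))
  rw [neg_add_cancel] at h2
  omega

/-- The sum of the weights `w` of the letters of a word. -/
def weight (w : A → ℝ) (u : List A) : ℝ := (u.map w).sum

@[simp] theorem weight_nil (w : A → ℝ) : weight w [] = 0 := rfl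

@[simp] theorem weight_singleton (w : A → ℝ) (a : A) : weight w [a] = w a := by
  simp [weight]

@[simp] theorem weight_append (w : A → ℝ) (u v : List A) :
    weight w (u ++ v) = weight w u + weight w v := by
  simp [weight]

@[simp] theorem weight_cons (w : A → ℝ) (a : A) (u : List A) :
    weight w (a :: u) = w a + weight w u := by
  simp [weight]

theorem weight_factor (w : A → ℝ) (x : ℤ → A) (t : ℤ) (n : ℕ) :
    weight w (factor x t n) = ∑ j ∈ Finset.range n, w (x (t + j)) := by
  induction n with
  | zero => simp
  | succ n ih => rw [factor_add, weight_append, ih, factor_one, weight_singleton,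
      Finset.sum_range_succ]

variable [Fintype A] [DecidableEq A]

theorem weight_eq_sum_count (w : A → ℝ) (u : List A) :
    weight w u = ∑ a, ((u.count a : ℕ) : ℝ) * w a := by
  induction u with
  | nil => simp
  | cons b u ih =>
    rw [weight_cons, ih]
    simp [List.count_cons, add_mul, Finset.sum_add_distrib, add_comm]

theorem transposeMap_apply (w : A → ℝ) (a : A) : transposeMap ξ w a = weight w (ξ a) := by
  rw [weight_eq_sum_count]
  simp [transposeMap, incidence, Matrix.vecMul, dotProduct, mul_comm]

theorem weight_expand (m : ℕ) (w : A → ℝ) (u : List A) :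
    weight w (expand ξ m u) = weight ((transposeMap ξ ^ m) w) u := by
  have one : ∀ (w : A → ℝ) (u : List A),
      weight w (expand ξ 1 u) = weight (transposeMap ξ w) u := by
    intro w u
    induction u with
    | nil => rfl
    | cons b u ih =>
      rw [expand_cons, weight_append, ih, weight_cons, substPow_one, transposeMap_apply]
  induction m generalizing w with
  | zero => simp
  | succ m ih => rw [← expand_expand, one, ih, pow_succ, Module.End.mul_apply]

end Entrance

/-! ### The series, its convergence and its behaviour under substitution and shift -/

section Series

theorem abs_weight_le {A : Type*} [Fintype A] (w : A → ℝ) (u : List A) : |weight w u| ≤ u.length * ‖w‖ := by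
  induction u with
  | nil => simp
  | cons a u ih =>
    rw [weight_cons, List.length_cons]
    have h1 : |w a| ≤ ‖w‖ := norm_le_pi_norm w a
    have h2 := abs_add_le (w a) (weight w u)
    push_cast
    linarith

variable {A : Type*} [Fintype A] [DecidableEq A] {ξ : A → List A}

/-- The pairing of the `k`-th return vector of `x` with `(Mᵗ) ^ k w`. -/
def pairing (ξ : A → List A) (w : A → ℝ) (x : ℤ → A) (k : ℕ) : ℝ :=
  ∑ a, (visits ξ k x a : ℝ) * (transposeMap ξ ^ k) w a

/-- The sum of the series of pairings. -/
def pairingSum (ξ : A → List A) (w : A → ℝ) (x : ℤ → A) : ℝ := ∑' k, pairing ξ w x k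

/-- The iterates of `w` under the transposed incidence matrix are summable. -/
def IsDecaying (ξ : A → List A) (w : A → ℝ) : Prop :=
  Summable fun k => ‖(transposeMap ξ ^ k) w‖

theorem IsDecaying.pow {w : A → ℝ} (h : IsDecaying ξ w) (m : ℕ) :
    IsDecaying ξ ((transposeMap ξ ^ m) w) := by
  have := (summable_nat_add_iff m).2 h
  simpa [IsDecaying, pow_add] using this

theorem Recognizable.pairing_eq (h : Recognizable ξ) (w : A → ℝ) {k : ℕ} {x y : ℤ → A} {c : ℤ → ℤ}
    (hy : y ∈ Omega ξ) (hc : Tiling (substPow ξ k) y x c) (h0 : c 0 = entrance ξ k x)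
    (h1 : c (-1) < 0) :
    pairing ξ w x k = weight ((transposeMap ξ ^ k) w) (factor y 0 (entrance ξ 1 y)) := by
  rw [weight_factor, pairing, ← Finset.sum_fiberwise _ fun j : ℕ => y j]
  refine Finset.sum_congr rfl fun a _ => ?_
  rw [h.visits_eq hy hc h0 h1, ← nsmul_eq_mul, ← Finset.sum_const]
  refine Finset.sum_congr rfl fun j hj => ?_
  rw [zero_add, (Finset.mem_filter.1 hj).2]

/-- The sum telescopes: the word of `x` between the entrances of levels n and n+1 is ξ^n of a prefix
of the desubstituted point, and its weight is the n-th pairing. -/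
theorem Recognizable.sum_pairing (h : Recognizable ξ) (w : A → ℝ) {x : ℤ → A} (hx : x ∈ Omega ξ)
    (n : ℕ) :
    ∑ k ∈ Finset.range n, pairing ξ w x k = weight w (factor x 0 (entrance ξ n x)) := by
  induction n with
  | zero =>
    obtain ⟨y, hy, c, hc, h0, h1⟩ := h.exists_entrance_tiling 0 hx
    have h2 := hc.1 (-1)
    simp only [neg_add_cancel, substPow_zero, List.length_singleton] at h2
    have : entrance ξ 0 x = 0 := by omega
    simp [this]
  | succ n ih =>
    obtain ⟨y, hy, c, hc, h0, h1⟩ := h.exists_entrance_tiling n hx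
    have h2 := h.entrance_add (n := 1) hy hc (by omega) h1
    have h3 := hc.apply_add 0 (entrance ξ 1 y)
    rw [zero_add, h0] at h3
    have h4 := hc.factor_eq 0 (entrance ξ 1 y)
    have h5 : entrance ξ (n + 1) x =
        entrance ξ n x + (expand ξ n (factor y 0 (entrance ξ 1 y))).length := by
      rw [add_comm n 1]; omega
    rw [Finset.sum_range_succ, ih, h.pairing_eq w hy hc h0 h1, h5, factor_add, weight_append,
      zero_add, ← h0, h4, weight_expand]

theorem Recognizable.abs_pairing_le (h : Recognizable ξ) (w : A → ℝ) {L : ℕ}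
    (hL : ∀ a, (substPow ξ 1 a).length ≤ L) {x : ℤ → A} (hx : x ∈ Omega ξ) (k : ℕ) :
    |pairing ξ w x k| ≤ L * ‖(transposeMap ξ ^ k) w‖ := by
  obtain ⟨y, hy, c, hc, h0, h1⟩ := h.exists_entrance_tiling k hx
  rw [h.pairing_eq w hy hc h0 h1]
  refine (abs_weight_le _ _).trans ?_
  rw [length_factor]
  have : ((entrance ξ 1 y : ℕ) : ℝ) ≤ L := by exact_mod_cast h.entrance_one_le hL hy
  gcongr

theorem Recognizable.summable_pairing (h : Recognizable ξ) {w : A → ℝ} (hw : IsDecaying ξ w)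
    {x : ℤ → A} (hx : x ∈ Omega ξ) : Summable (pairing ξ w x) := by
  obtain ⟨L, hL⟩ := exists_length_le ξ 1
  exact Summable.of_norm_bounded (hw.mul_left (L : ℝ)) fun k => h.abs_pairing_le w hL hx k

theorem Recognizable.abs_pairingSum_le (h : Recognizable ξ) {w : A → ℝ} (hw : IsDecaying ξ w)
    {L : ℕ} (hL : ∀ a, (substPow ξ 1 a).length ≤ L) {x : ℤ → A} (hx : x ∈ Omega ξ) :
    |pairingSum ξ w x| ≤ L * ∑' k, ‖(transposeMap ξ ^ k) w‖ := by
  rw [← tsum_mul_left, ← Real.norm_eq_abs, pairingSum]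
  exact tsum_of_norm_bounded (hw.mul_left (L : ℝ)).hasSum fun k => h.abs_pairing_le w hL hx k

theorem Recognizable.tendsto_weight (h : Recognizable ξ) {w : A → ℝ} (hw : IsDecaying ξ w)
    {x : ℤ → A} (hx : x ∈ Omega ξ) :
    Tendsto (fun n => weight w (factor x 0 (entrance ξ n x))) atTop (𝓝 (pairingSum ξ w x)) := by
  have := (h.summable_pairing hw hx).hasSum.tendsto_sum_nat
  simpa only [h.sum_pairing w hx, pairingSum] using this

/-- The prefix of `x` up to its entrance of level n+m is ξ^m of the prefix of `y` up to its entrance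
of level n; `weight_expand` moves ξ^m to the weights. -/
theorem Recognizable.pairingSum_image (h : Recognizable ξ) {w : A → ℝ} (hw : IsDecaying ξ w)
    {m : ℕ} {x y : ℤ → A} (hy : y ∈ Omega ξ) (hx : IsImage (substPow ξ m) y x) :
    pairingSum ξ w x = pairingSum ξ ((transposeMap ξ ^ m) w) y := by
  obtain ⟨c, hc0, hc : Tiling _ _ _ _⟩ := hx
  have hxO := hc.mem_Omega h.ne_nil hy
  have h1 := (tendsto_add_atTop_iff_nat m).2 (h.tendsto_weight hw hxO)
  have h2 := h.tendsto_weight (hw.pow m) hy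
  refine tendsto_nhds_unique h1 (h2.congr fun n => ?_)
  have hm : c (-1) < 0 := by
    rw [← hc0]; exact hc.strictMono (h.length_pos m) (by norm_num)
  have h3 := h.entrance_add (n := n) hy hc hc0.ge hm
  have h4 := hc.apply_add 0 (entrance ξ n y)
  have h5 := hc.factor_eq 0 (entrance ξ n y)
  rw [zero_add, hc0, zero_add, ← h3] at h4
  rw [hc0] at h5
  rw [← weight_expand, ← h5]
  congr 2
  exact_mod_cast h4.symm

/-- Shifting deletes the first letter of the prefix, without error, unless `x` already lies in the
base. In that case the prefix is empty and the error is the weight of one whole tile of level n. -/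
theorem Recognizable.weight_shift (h : Recognizable ξ) (w : A → ℝ) {x : ℤ → A} (hx : x ∈ Omega ξ)
    (n : ℕ) :
    |weight w (factor x 0 (entrance ξ n x)) - w (x 0) -
      weight w (factor (translate 1 x) 0 (entrance ξ n (translate 1 x)))| ≤
      ‖(transposeMap ξ ^ n) w‖ := by
  obtain ⟨y, hy, c, hc, h0, h1⟩ := h.exists_entrance_tiling n hx
  rcases Nat.eq_zero_or_pos (entrance ξ n x) with he | he
  · have h2 := hc.translate 1 1
    have hy' := translate_mem_Omega (ξ := ξ) 1 hy
    have hpos := h.length_pos n (y 0)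
    obtain ⟨l, hl⟩ := Nat.exists_eq_add_of_lt hpos
    have h3 := hc.1 0
    rw [zero_add] at h3
    have h4 : entrance ξ n (translate 1 x) = l :=
      h.entrance_eq hy' h2 (by rw [zero_add]; omega) (by rw [neg_add_cancel]; omega)
    have h5 := hc.factor_one 0
    have h6 : w (x 0) + weight w (factor x (0 + (1 : ℕ)) l) = (transposeMap ξ ^ n) w (y 0) := by
      rw [← weight_singleton w (x 0), ← factor_one, ← weight_append, ← factor_add, add_comm 1 l,
        ← weight_singleton ((transposeMap ξ ^ n) w), ← weight_expand, expand_singleton, ← h5, h0, he]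
      congr 2
      omega
    rw [he, h4, factor_zero, weight_nil, factor_translate]
    have h7 := norm_le_pi_norm ((transposeMap ξ ^ n) w) (y 0)
    rw [← h6, Real.norm_eq_abs] at h7
    rw [zero_sub, ← neg_add', abs_neg]
    exact h7
  · have h2 := hc.translate 0 1
    rw [translate_zero] at h2
    obtain ⟨l, hl⟩ := Nat.exists_eq_add_of_lt he
    have h4 : entrance ξ n (translate 1 x) = l :=
      h.entrance_eq hy h2 (by rw [zero_add]; omega) (by rw [add_zero]; omega)
    rw [h4, hl, factor_translate, zero_add, add_comm l 1, factor_add, weight_append, factor_one,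
      weight_singleton]
    simp

theorem Recognizable.pairingSum_translate_one (h : Recognizable ξ) {w : A → ℝ}
    (hw : IsDecaying ξ w) {x : ℤ → A} (hx : x ∈ Omega ξ) :
    pairingSum ξ w (translate 1 x) = pairingSum ξ w x - w (x 0) := by
  have h1 := (h.tendsto_weight hw hx).sub_const (w (x 0))
  have h2 := h.tendsto_weight hw (translate_mem_Omega 1 hx)
  have h3 : Tendsto (fun n => ‖(transposeMap ξ ^ n) w‖) atTop (𝓝 0) := hw.tendsto_atTop_zero
  have h4 := squeeze_zero_norm (fun n => (Real.norm_eq_abs _).trans_le (h.weight_shift w hx n)) h3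
  have h5 := h1.sub h4
  rw [sub_zero] at h5
  exact tendsto_nhds_unique h2 (h5.congr fun n => by ring)

theorem Recognizable.pairingSum_shift (h : Recognizable ξ) {w : A → ℝ}
    (hw : IsDecaying ξ w) {x : ℤ → A} (hx : x ∈ Omega ξ) (k : ℕ) :
    pairingSum ξ w (shift^[k] x) = pairingSum ξ w x - weight w (factor x 0 k) := by
  rw [shift_iterate]
  induction k with
  | zero => simp
  | succ k ih =>
    have h1 := h.pairingSum_translate_one hw (translate_mem_Omega k hx)
    rw [translate_translate, add_comm (1 : ℤ) k] at h1
    push_cast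
    rw [h1, ih, factor_add, weight_append, factor_one, weight_singleton]
    simp
    ring

/-- On a piece of the tower of level `m`, the sum of the series is, up to a constant, the sum of
the series of `(Mᵗ) ^ m w` at the desubstituted point. -/
theorem Recognizable.pairingSum_tower (h : Recognizable ξ) {w : A → ℝ} (hw : IsDecaying ξ w)
    {m k : ℕ} {y x : ℤ → A} (hy : y ∈ Omega ξ) (hx : IsImage (substPow ξ m) y x)
    (hk : k < (substPow ξ m (y 0)).length) :
    pairingSum ξ w (shift^[k] x) =
      pairingSum ξ ((transposeMap ξ ^ m) w) y - weight w ((substPow ξ m (y 0)).take k) := by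
  obtain ⟨c, hc0, hc : Tiling _ _ _ _⟩ := id hx
  rw [h.pairingSum_shift hw (hc.mem_Omega h.ne_nil hy), h.pairingSum_image hw hy hx]
  have h1 := hc.factor_one 0
  obtain ⟨l, hl⟩ := Nat.exists_eq_add_of_lt hk
  rw [hl, hc0, add_assoc, factor_add] at h1
  rw [← h1, List.take_left' (by simp)]

end Series

/-! ### Decay on the stable space, and F in terms of the series -/

section Stable

theorem summable_of_le_half {a : ℕ → ℝ} (h0 : ∀ k, 0 ≤ a k) {m : ℕ}
    (h : ∀ k, a (k + m) ≤ a k / 2) : Summable a := by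
  refine summable_of_sum_range_le (c := 2 * ∑ k ∈ Finset.range m, a k) h0 fun n => ?_
  have h1 : ∑ k ∈ Finset.range n, a k ≤ ∑ k ∈ Finset.range (m + n), a k :=
    Finset.sum_le_sum_of_subset_of_nonneg (Finset.range_subset_range.2 (by omega))
      fun k _ _ => h0 k
  rw [Finset.sum_range_add] at h1
  have h2 : ∑ k ∈ Finset.range n, a (m + k) ≤ (∑ k ∈ Finset.range n, a k) / 2 := by
    rw [Finset.sum_div]
    exact Finset.sum_le_sum fun k _ => by rw [add_comm]; exact h k
  linarith

/-- In finite dimension, pointwise convergence on a basis is uniform on the unit ball. -/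
theorem exists_norm_pow_le_half {A : Type*} [Fintype A] (f : (A → ℝ) →ₗ[ℝ] (A → ℝ)) :
    ∃ m : ℕ, ∀ v ∈ contracted f, ‖(f ^ m) v‖ ≤ ‖v‖ / 2 := by
  let b := Module.finBasis ℝ (contracted f)
  obtain ⟨C, hC0, hC⟩ := (b.equivFunL.toContinuousLinearMap).bound
  have h1 : ∀ i, Tendsto (fun m => ‖(f ^ m) (b i : A → ℝ)‖) atTop (𝓝 0) := fun i => by
    have h : Tendsto (fun k : ℕ => (f ^ k) (b i : A → ℝ)) atTop (𝓝 0) := (b i).2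
    simpa using h.norm
  have h2 : Tendsto (fun m => ∑ i, C * ‖(f ^ m) (b i : A → ℝ)‖) atTop (𝓝 0) := by
    simpa using tendsto_finsetSum Finset.univ fun i _ => (h1 i).const_mul C
  obtain ⟨m, hm⟩ := (h2.eventually_le_const (show (0 : ℝ) < 1 / 2 by norm_num)).exists
  refine ⟨m, fun v hv => ?_⟩
  have e : v = ∑ i, b.equivFun ⟨v, hv⟩ i • (b i : A → ℝ) := by
    have := congrArg (Submodule.subtype _) (b.sum_equivFun ⟨v, hv⟩)
    simp only [map_sum, map_smul, Submodule.subtype_apply] at this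
    exact this.symm
  have h3 : ∀ i, |b.equivFun ⟨v, hv⟩ i| ≤ C * ‖v‖ := fun i =>
    (norm_le_pi_norm (b.equivFun ⟨v, hv⟩) i).trans (hC ⟨v, hv⟩)
  calc ‖(f ^ m) v‖ = ‖∑ i, b.equivFun ⟨v, hv⟩ i • (f ^ m) (b i : A → ℝ)‖ := by
        conv_lhs => rw [e]
        simp
    _ ≤ ∑ i, ‖b.equivFun ⟨v, hv⟩ i • (f ^ m) (b i : A → ℝ)‖ := norm_sum_le _ _
    _ ≤ ∑ i, ‖v‖ * (C * ‖(f ^ m) (b i : A → ℝ)‖) := by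
        refine Finset.sum_le_sum fun i _ => ?_
        rw [norm_smul, Real.norm_eq_abs]
        nlinarith [mul_le_mul_of_nonneg_right (h3 i) (norm_nonneg ((f ^ m) (b i : A → ℝ)))]
    _ = ‖v‖ * ∑ i, C * ‖(f ^ m) (b i : A → ℝ)‖ := by rw [Finset.mul_sum]
    _ ≤ ‖v‖ * (1 / 2) := mul_le_mul_of_nonneg_left hm (norm_nonneg v)
    _ = ‖v‖ / 2 := by ring

variable {A : Type*} [Fintype A] [DecidableEq A] {ξ : A → List A}

theorem isDecaying_of_mem_contracted {v : A → ℝ} (hv : v ∈ contracted (transposeMap ξ)) :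
    IsDecaying ξ v := by
  obtain ⟨m, hm⟩ := exists_norm_pow_le_half (transposeMap ξ)
  refine summable_of_le_half (m := m) (fun k => norm_nonneg _) fun k => ?_
  rw [add_comm, pow_add, Module.End.mul_apply]
  refine hm _ ?_
  have h1 : Tendsto (fun j : ℕ => (transposeMap ξ ^ (j + k)) v) atTop (𝓝 0) :=
    (tendsto_add_atTop_iff_nat k).2 hv
  simpa [contracted, pow_add] using h1

theorem isDecaying_of_mem_Es {v : A → ℝ} (hv : v ∈ Es ξ) : IsDecaying ξ v :=
  isDecaying_of_mem_contracted (Submodule.mem_inf.1 hv).1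

theorem stablePart_mem_Es (ξ : A → List A) (α : ℝ) : stablePart ξ α ∈ Es ξ := by
  unfold stablePart
  split_ifs with h
  · exact h.choose_spec.1
  · exact Submodule.zero_mem _

/-- The image of the stable part under the transposed incidence matrix. -/
def stableImage (ξ : A → List A) (α : ℝ) : A → ℝ := transposeMap ξ (stablePart ξ α)

theorem stableImage_mem_Es (ξ : A → List A) (α : ℝ) : stableImage ξ α ∈ Es ξ :=
  transposeMap_mem_Es ξ _ (stablePart_mem_Es ξ α)

theorem isDecaying_stableImage (ξ : A → List A) (α : ℝ) : IsDecaying ξ (stableImage ξ α) :=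
  isDecaying_of_mem_Es (stableImage_mem_Es ξ α)

/-- The extra factor M^t in `Fterm` is absorbed by `stableImage`, so that level and exponent agree.
-/
theorem Fterm_apply {n : ℕ} (α : Fin n → ℝ) (x : ℤ → A) (k : ℕ) (i : Fin n) :
    Fterm ξ α x k i = pairing ξ (stableImage ξ (α i)) x k := by
  simp only [Fterm, pairing, stableImage, pow_succ, Module.End.mul_apply]

theorem Recognizable.summable_Fterm (h : Recognizable ξ) {n : ℕ} (α : Fin n → ℝ) {x : ℤ → A}
    (hx : x ∈ Omega ξ) : Summable (Fterm ξ α x) := by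
  rw [Pi.summable]
  intro i
  simp only [Fterm_apply]
  exact h.summable_pairing (isDecaying_stableImage ξ _) hx

theorem Recognizable.F_apply (h : Recognizable ξ) {n : ℕ} (α : Fin n → ℝ) {x : ℤ → A}
    (hx : x ∈ Omega ξ) (i : Fin n) : F ξ α x i = pairingSum ξ (stableImage ξ (α i)) x := by
  rw [F, tsum_apply (h.summable_Fterm α hx), pairingSum]
  simp only [Fterm_apply]

theorem Recognizable.pairingSum_sum (h : Recognizable ξ) {ι : Type*} [Fintype ι] (c : ι → ℝ)
    {w : ι → A → ℝ} (hw : ∀ i, IsDecaying ξ (w i)) {x : ℤ → A} (hx : x ∈ Omega ξ) :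
    pairingSum ξ (∑ i, c i • w i) x = ∑ i, c i * pairingSum ξ (w i) x := by
  simp only [pairingSum, ← tsum_mul_left]
  rw [← Summable.tsum_finsetSum fun i _ => (h.summable_pairing (hw i) hx).mul_left (c i)]
  refine tsum_congr fun k => ?_
  simp only [pairing, map_sum, map_smul, Finset.sum_apply, Pi.smul_apply, smul_eq_mul,
    Finset.mul_sum]
  rw [Finset.sum_comm]
  exact Finset.sum_congr rfl fun i _ => Finset.sum_congr rfl fun a _ => by ring

end Stable

/-! ### Aperiodicity from an irrational eigenvalue -/

section Aperiodic

variable {A : Type*} [MeasurableSpace A] {ξ : A → List A} {μ : Measure (ℤ → A)}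

theorem IsInvariantProb.ae_mem_Omega (hμ : IsInvariantProb ξ μ) : ∀ᵐ x ∂μ, x ∈ Omega ξ :=
  hμ.support

/-- If S^d were the identity on Ω, an eigenfunction would satisfy f = z^d f, hence z^d = 1 and dα
would be an integer. -/
theorem IsInvariantProb.not_exists_period (hμ : IsInvariantProb ξ μ) {α : ℝ}
    (hα : Irrational α)
    (h : IsEigenvalue μ (Complex.exp (2 * Real.pi * Complex.I * (α : ℂ)))) :
    ¬ ∃ d : ℕ, 0 < d ∧ ∀ x ∈ Omega ξ, ∀ i : ℤ, x (i + d) = x i := by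
  rintro ⟨d, hd, hper⟩
  obtain ⟨f, -, hf0, hf⟩ := h
  set z := Complex.exp (2 * Real.pi * Complex.I * (α : ℂ)) with hz
  have hiter : ∀ k : ℕ, ∀ᵐ x ∂μ, f (shift^[k] x) = z ^ k * f x := by
    intro k
    induction k with
    | zero => simp
    | succ k ih =>
      filter_upwards [hμ.invariant.quasiMeasurePreserving.ae ih, hf] with x h1 h2
      rw [Function.iterate_succ_apply, h1, h2, pow_succ, mul_assoc]
  have hzd : z ^ d = 1 := by
    by_contra hne
    refine hf0 ?_
    filter_upwards [hiter d, hμ.ae_mem_Omega] with x h1 h2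
    have h3 : shift^[d] x = x := by
      rw [shift_iterate]
      funext i
      exact hper x h2 i
    rw [h3] at h1
    have h4 : (z ^ d - 1) * f x = 0 := by rw [sub_mul, ← h1, one_mul, sub_self]
    exact (mul_eq_zero.1 h4).resolve_left (sub_ne_zero.2 hne)
  rw [hz, ← Complex.exp_nat_mul, Complex.exp_eq_one_iff] at hzd
  obtain ⟨n, hn⟩ := hzd
  have h1 : (d : ℂ) * α = n := by
    have : (2 * Real.pi * Complex.I : ℂ) ≠ 0 := Complex.two_pi_I_ne_zero
    refine mul_right_cancel₀ this ?_
    rw [← hn]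
    ring
  have h2 : (d : ℝ) * α = n := by exact_mod_cast h1
  have hd' : (d : ℝ) ≠ 0 := by exact_mod_cast hd.ne'
  refine hα ⟨n / d, ?_⟩
  push_cast
  rw [← h2, mul_div_cancel_left₀ _ hd']

variable [Fintype A] [DecidableEq A]

/-- On a zero stable space the determinant is 1, so β would be 1, contradicting the root of modulus
greater than 1. -/
theorem HypothesesP.pos {n : ℕ} {α : Fin n → ℝ} (hP : HypothesesP ξ μ α) : 0 < n := by
  by_contra hn
  obtain ⟨β, hβ, hdet⟩ := hP.unimodular
  have h0 : Module.finrank ℝ (Es ξ) = 0 := by rw [hP.dim_stable]; omega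
  rw [detEs, LinearMap.det_eq_one_of_finrank_eq_zero h0, abs_one, mul_one] at hdet
  obtain ⟨z, ⟨hz, hz1⟩, -⟩ := hP.unique_root
  rcases eq_or_ne z β with rfl | hne
  · rw [hdet] at hz1
    simp at hz1
  · have := hβ.2 z hz hne
    linarith

theorem HypothesesP.irrational {n : ℕ} {α : Fin n → ℝ} (hP : HypothesesP ξ μ α) (i : Fin n) :
    Irrational (α i) := by
  rintro ⟨q, hq⟩
  have h1 := hP.independent
  rw [Fintype.linearIndependent_iff] at h1
  have h2 := h1 (Fin.cons q (fun j => if j = i then -1 else 0)) (by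
    rw [Fin.sum_univ_succ]
    simp [Rat.smul_def, hq]) i.succ
  simp at h2

theorem HypothesesP.recognizable (hμ : IsInvariantProb ξ μ) {n : ℕ} {α : Fin n → ℝ}
    (hP : HypothesesP ξ μ α) : Recognizable ξ :=
  PrimSubst.recognizable hP.proper.ne_nil hP.primitive
    (hμ.not_exists_period (hP.irrational ⟨0, hP.pos⟩) (hP.eigenvalue _))

end Aperiodic

/-! ### Perron-Frobenius theory for primitive matrices -/

section PerronFrobenius

variable {A : Type*} [Fintype A] [DecidableEq A] {M : Matrix A A ℝ}

theorem mulVec_pos {A : Type*} [Fintype A] {N : Matrix A A ℝ} (hN : ∀ a b, 0 < N a b) {x : A → ℝ} (hx : ∀ a, 0 ≤ x a)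
    (hx0 : x ≠ 0) (a : A) : 0 < N.mulVec x a := by
  obtain ⟨b, hb⟩ : ∃ b, x b ≠ 0 := by
    by_contra! h
    exact hx0 (funext h)
  exact Finset.sum_pos' (fun c _ => mul_nonneg (hN a c).le (hx c))
    ⟨b, Finset.mem_univ b, mul_pos (hN a b) (lt_of_le_of_ne (hx b) hb.symm)⟩

theorem pow_mulVec_eigenvector {r : ℝ} {x : A → ℝ} (h : M.mulVec x = r • x) (k : ℕ) :
    (M ^ k).mulVec x = r ^ k • x := by
  induction k with
  | zero => simp
  | succ k ih =>
    rw [pow_succ, ← Matrix.mulVec_mulVec, h, Matrix.mulVec_smul, ih, smul_smul, pow_succ']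

/-- Collatz-Wielandt: maximise r subject to r x ≤ M x over the simplex. If the maximiser were not an
eigenvector, the positive power M^k would turn the gap M x - r x into a strictly positive vector and
r could be increased. -/
theorem exists_pos_eigenvector [Nonempty A] (hM : M.IsPrimitive) :
    ∃ r : ℝ, 0 < r ∧ ∃ p : A → ℝ, (∀ a, 0 < p a) ∧ M.mulVec p = r • p := by
  obtain ⟨h0, k, hk, hpos⟩ := hM
  let S : Set (ℝ × (A → ℝ)) :=
    {q | 0 ≤ q.1 ∧ q.2 ∈ stdSimplex ℝ A ∧ ∀ a, q.1 * q.2 a ≤ M.mulVec q.2 a}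
  let R : ℝ := ∑ a, ∑ b, M a b
  have hR : ∀ q ∈ S, q.1 ≤ R := by
    rintro ⟨r, x⟩ ⟨-, ⟨hx0, hx1⟩, h⟩
    simp only at hx0 hx1 h
    have hle : ∀ b, x b ≤ 1 := fun b => by
      rw [← hx1]
      exact Finset.single_le_sum (fun a _ => hx0 a) (Finset.mem_univ b)
    calc r = ∑ a, r * x a := by rw [← Finset.mul_sum, hx1, mul_one]
      _ ≤ ∑ a, M.mulVec x a := Finset.sum_le_sum fun a _ => h a
      _ ≤ R := Finset.sum_le_sum fun a _ => Finset.sum_le_sum fun b _ =>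
        mul_le_of_le_one_right (h0 a b) (hle b)
  have hcont : Continuous fun q : ℝ × (A → ℝ) => M.mulVec q.2 :=
    continuous_const.matrix_mulVec continuous_snd
  have hSc : IsCompact S := by
    refine (isCompact_Icc.prod (isCompact_stdSimplex ℝ A)).of_isClosed_subset (s := Set.Icc 0 R ×ˢ
      stdSimplex ℝ A) ?_ fun q hq => ⟨⟨hq.1, hR q hq⟩, hq.2.1⟩
    have h1 : IsClosed {q : ℝ × (A → ℝ) | ∀ a, q.1 * q.2 a ≤ M.mulVec q.2 a} := by
      have e : {q : ℝ × (A → ℝ) | ∀ a, q.1 * q.2 a ≤ M.mulVec q.2 a} =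
          ⋂ a, {q : ℝ × (A → ℝ) | q.1 * q.2 a ≤ M.mulVec q.2 a} := by
        ext; simp
      rw [e]
      exact isClosed_iInter fun a => isClosed_le
        (continuous_fst.mul ((continuous_apply a).comp continuous_snd))
        ((continuous_apply a).comp hcont)
    exact (isClosed_le continuous_const continuous_fst).inter
      (((isClosed_stdSimplex ℝ A).preimage continuous_snd).inter h1)
  have hSn : S.Nonempty := by
    obtain ⟨a⟩ := ‹Nonempty A›
    refine ⟨(0, Pi.single a 1), le_rfl, single_mem_stdSimplex ℝ a, fun b => ?_⟩
    simp [h0]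
  obtain ⟨⟨r, x⟩, ⟨hr0, ⟨hx0, hx1⟩, hrx⟩, hmax⟩ := hSc.exists_isMaxOn hSn continuous_fst.continuousOn
  simp only at hr0 hx0 hx1 hrx
  have hxne : x ≠ 0 := by
    rintro rfl
    simp at hx1
  have hy := mulVec_pos hpos hx0 hxne
  set y := (M ^ k).mulVec x with hydef
  have heig : M.mulVec x = r • x := by
    by_contra hne
    have hz := mulVec_pos hpos (x := M.mulVec x - r • x)
      (fun a => by simpa using hrx a) (sub_ne_zero.2 hne)
    have hz' : (M ^ k).mulVec (M.mulVec x - r • x) = M.mulVec y - r • y := by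
      rw [Matrix.mulVec_sub, Matrix.mulVec_smul, Matrix.mulVec_mulVec, hydef, Matrix.mulVec_mulVec,
        ← pow_succ, ← pow_succ']
    rw [hz'] at hz
    obtain ⟨a₀, ha₀⟩ := Finite.exists_min fun a => (M.mulVec y - r • y) a / y a
    set ε := (M.mulVec y - r • y) a₀ / y a₀ with hε
    have hεpos : 0 < ε := div_pos (hz a₀) (hy a₀)
    have hs : 0 < ∑ a, y a := Finset.sum_pos (fun a _ => hy a) Finset.univ_nonempty
    have hmem : (r + ε, (∑ a, y a)⁻¹ • y) ∈ S := by
      refine ⟨by positivity, ⟨fun a => ?_, ?_⟩, fun a => ?_⟩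
      · simp only [Pi.smul_apply, smul_eq_mul]
        have := hy a
        positivity
      · simp only [Pi.smul_apply, smul_eq_mul, ← Finset.mul_sum]
        exact inv_mul_cancel₀ hs.ne'
      · have h1 := (le_div_iff₀ (hy a)).1 (ha₀ a)
        simp only [Pi.sub_apply, Pi.smul_apply, smul_eq_mul] at h1
        rw [Matrix.mulVec_smul]
        simp only [Pi.smul_apply, smul_eq_mul]
        have h2 : (0 : ℝ) ≤ (∑ a, y a)⁻¹ := by positivity
        nlinarith [mul_le_mul_of_nonneg_left h1 h2]
    have := hmax hmem
    simp only [Set.mem_ofPred_eq] at this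
    linarith
  have hpow := pow_mulVec_eigenvector heig k
  have hrk : ∀ a, 0 < r ^ k * x a := fun a => by
    have := hy a
    rw [hydef, hpow] at this
    simpa using this
  have hr : r ≠ 0 := by
    rintro rfl
    obtain ⟨a⟩ := ‹Nonempty A›
    have := hrk a
    rw [zero_pow hk.ne'] at this
    simp at this
  exact ⟨r, lt_of_le_of_ne hr0 hr.symm, x, fun a => pos_of_mul_pos_right (hrk a) (by positivity),
    heig⟩

theorem isRoot_charpoly_iff {z : ℂ} :
    ((M.charpoly).map (algebraMap ℝ ℂ)).IsRoot z ↔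
      ∃ w : A → ℂ, w ≠ 0 ∧ (M.map (algebraMap ℝ ℂ)).mulVec w = z • w := by
  rw [← Matrix.charpoly_map, Polynomial.IsRoot, Matrix.eval_charpoly,
    ← Matrix.exists_mulVec_eq_zero_iff]
  refine exists_congr fun w => and_congr_right fun _ => ?_
  rw [Matrix.sub_mulVec, sub_eq_zero, eq_comm]
  simp [Matrix.scalar_apply, ← Matrix.smul_one_eq_diagonal, Matrix.smul_mulVec]

/-- Evaluate the eigenvector equation at the coordinate where ‖w a‖ / p a is largest. -/
theorem norm_le_of_isRoot_charpoly (h0 : ∀ a b, 0 ≤ M a b) {r : ℝ} {p : A → ℝ}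
    (hp : ∀ a, 0 < p a) (hMp : M.mulVec p = r • p) {z : ℂ}
    (hz : ((M.charpoly).map (algebraMap ℝ ℂ)).IsRoot z) : ‖z‖ ≤ r := by
  obtain ⟨w, hw0, hw⟩ := isRoot_charpoly_iff.1 hz
  obtain ⟨b, hb⟩ : ∃ b, w b ≠ 0 := by
    by_contra! h
    exact hw0 (funext h)
  have : Nonempty A := ⟨b⟩
  obtain ⟨a, ha⟩ := Finite.exists_max fun a => ‖w a‖ / p a
  set t := ‖w a‖ / p a with ht
  have htpos : 0 < t := (div_pos (norm_pos_iff.2 hb) (hp b)).trans_le (ha b)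
  have h1 : ∀ c, ‖w c‖ ≤ t * p c := fun c => (div_le_iff₀ (hp c)).1 (ha c)
  have h2 : ‖w a‖ = t * p a := by rw [ht, div_mul_cancel₀ _ (hp a).ne']
  have h3 : ‖z‖ * ‖w a‖ ≤ t * (r * p a) := by
    have e1 := congrFun hw a
    have e2 := congrFun hMp a
    simp only [Pi.smul_apply, smul_eq_mul] at e1 e2
    rw [← norm_mul, ← e1, ← e2]
    simp only [Matrix.mulVec, dotProduct, Matrix.map_apply]
    refine (norm_sum_le _ _).trans ?_
    rw [Finset.mul_sum]
    refine Finset.sum_le_sum fun c _ => ?_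
    rw [norm_mul, norm_algebraMap', Real.norm_of_nonneg (h0 a c)]
    nlinarith [mul_le_mul_of_nonneg_left (h1 c) (h0 a c)]
  rw [h2] at h3
  have h4 : 0 < t * p a := mul_pos htpos (hp a)
  nlinarith

/-- The number r is a root and bounds the modulus of every root; a dominant β different from r would
have to exceed it. -/
theorem IsPerronNumber.eq {ξ : A → List A} {β : ℝ} (hβ : IsPerronNumber ξ β) {r : ℝ} (hr : 0 < r)
    {p : A → ℝ} (hp : ∀ a, 0 < p a) [Nonempty A] (hMp : (incidence ξ).mulVec p = r • p) :
    β = r := by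
  have h0 : ∀ a b, 0 ≤ incidence ξ a b := fun a b => by simp [incidence]
  have h1 := norm_le_of_isRoot_charpoly h0 hp hMp hβ.1
  have h2 : (r : ℂ) ∈ complexRoots ξ := by
    refine isRoot_charpoly_iff.2 ⟨fun a => (p a : ℂ), ?_, ?_⟩
    · obtain ⟨a⟩ := ‹Nonempty A›
      intro h
      have := congrFun h a
      simp only [Pi.zero_apply, Complex.ofReal_eq_zero] at this
      exact (hp a).ne' this
    · funext a
      have := congrFun hMp a
      simp only [Matrix.mulVec, dotProduct, Pi.smul_apply, smul_eq_mul] at this ⊢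
      rw [← Complex.ofReal_mul, ← this]
      simp
  by_contra hne
  have h3 := hβ.2 r h2 fun h => hne (by exact_mod_cast h.symm)
  rw [Complex.norm_real, Real.norm_of_nonneg hr.le] at h3
  rw [Complex.norm_real] at h1
  have := Real.le_norm_self β
  linarith

/-- A subinvariant vector of a primitive matrix is an eigenvector. -/
theorem exists_eq_smul_of_le [Nonempty A] {r : ℝ} {p : A → ℝ}
    (hp : ∀ a, 0 < p a) (hMp : M.mulVec p = r • p) {k : ℕ} (hk : ∀ a b, 0 < (M ^ k) a b)
    {u : A → ℝ} (hu : ∀ a, r ^ k * u a ≤ (M ^ k).mulVec u a) : ∃ t : ℝ, u = t • p := by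
  -- With t the largest ratio, t p - u is nonnegative and vanishes at `a`. If it were nonzero, M^k
  -- would make it positive at `a`, against subinvariance.
  obtain ⟨a, ha⟩ := Finite.exists_max fun a => u a / p a
  set t := u a / p a with ht
  refine ⟨t, ?_⟩
  by_contra hne
  have h1 : ∀ c, 0 ≤ (t • p - u) c := fun c => by
    have := (div_le_iff₀ (hp c)).1 (ha c)
    simpa using this
  have h2 := mulVec_pos hk h1 (sub_ne_zero.2 (Ne.symm hne)) a
  rw [Matrix.mulVec_sub, Matrix.mulVec_smul, pow_mulVec_eigenvector hMp] at h2
  have h3 : u a = t * p a := by rw [ht, div_mul_cancel₀ _ (hp a).ne']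
  have h4 := hu a
  simp only [Pi.sub_apply, Pi.smul_apply, smul_eq_mul] at h2
  rw [h3] at h4
  linarith [mul_left_comm t (r ^ k) (p a)]

/-- A sequence of nonnegative vectors `h m = M h (m + 1)` consists of multiples of the Perron
vector. -/
theorem exists_eq_smul_of_backward_orbit [Nonempty A] (hM : M.IsPrimitive) {r : ℝ} (hr : 0 < r)
    {p : A → ℝ} (hp : ∀ a, 0 < p a) (hMp : M.mulVec p = r • p) {h : ℕ → A → ℝ}
    (h0 : ∀ m a, 0 ≤ h m a) (hh : ∀ m, h m = M.mulVec (h (m + 1))) :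
    ∃ t : ℝ, ∀ m, r ^ m • h m = t • p := by
  have hMT : M.transpose.IsPrimitive := by
    obtain ⟨h1, k, hk, h2⟩ := hM
    exact ⟨fun a b => h1 b a, k, hk, fun a b => by
      rw [← Matrix.transpose_pow]; exact h2 b a⟩
  -- A positive left eigenvector; pairing it with `p` shows that its eigenvalue is again r. It gives
  -- the conserved quantity of the orbit.
  obtain ⟨r', hr', l, hl, hMl⟩ := exists_pos_eigenvector hMT
  obtain ⟨hM0, k, hk, hpos⟩ := hM
  rw [Matrix.mulVec_transpose] at hMl
  have hlp : 0 < l ⬝ᵥ p :=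
    Finset.sum_pos (fun a _ => mul_pos (hl a) (hp a)) Finset.univ_nonempty
  have hrr : r' = r := by
    have h1 := Matrix.dotProduct_mulVec l M p
    rw [hMp, hMl, dotProduct_smul, smul_dotProduct, smul_eq_mul, smul_eq_mul] at h1
    exact (mul_right_cancel₀ hlp.ne' h1).symm
  rw [hrr] at hMl
  have hMlk : Matrix.vecMul l (M ^ k) = r ^ k • l := by
    have h1 := pow_mulVec_eigenvector (M := M.transpose) (r := r) (x := l)
      (by rw [Matrix.mulVec_transpose, hMl]) k
    rwa [← Matrix.transpose_pow, Matrix.mulVec_transpose] at h1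
  have hconst : ∀ m, l ⬝ᵥ (r ^ m • h m) = l ⬝ᵥ h 0 := by
    intro m
    induction m with
    | zero => simp
    | succ m ih =>
      rw [← ih, hh m, dotProduct_smul, dotProduct_smul, Matrix.dotProduct_mulVec, hMl,
        smul_dotProduct, smul_smul, pow_succ]
  set t := (l ⬝ᵥ h 0) / (l ⬝ᵥ p) with ht
  refine ⟨t, fun m => ?_⟩
  -- The deviation from the Perron direction, annihilated by `l` thanks to the choice of `t`.
  let d : ℕ → A → ℝ := fun m => r ^ m • h m - t • p
  have hd0 : ∀ m, l ⬝ᵥ d m = 0 := fun m => by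
    simp only [d]
    rw [dotProduct_sub, hconst, dotProduct_smul, smul_eq_mul, ht, div_mul_cancel₀ _ hlp.ne',
      sub_self]
  have hd : ∀ m, (M ^ k).mulVec (d (m + k)) = r ^ k • d m := by
    have h1 : ∀ j m, (M ^ j).mulVec (h (m + j)) = h m := by
      intro j
      induction j with
      | zero => simp
      | succ j ih =>
        intro m
        rw [pow_succ, ← Matrix.mulVec_mulVec, ← add_assoc, ← hh, ih]
    intro m
    simp only [d]
    rw [Matrix.mulVec_sub, Matrix.mulVec_smul, Matrix.mulVec_smul, h1,
      pow_mulVec_eigenvector hMp, smul_sub]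
    simp only [smul_smul]
    rw [pow_add, mul_comm t, mul_comm (r ^ m)]
  let N : ℕ → ℝ := fun m => ∑ a, l a * |d m a|
  -- Doeblin's trick: M^k dominates ε p lᵗ. Subtracting this rank one matrix does not affect vectors
  -- killed by `l`, but it lowers the eigenvalue of `l`, so the norm weighted by `l` contracts.
  obtain ⟨⟨a₀, b₀⟩, hmin⟩ := Finite.exists_min fun q : A × A => (M ^ k) q.1 q.2 / (p q.1 * l q.2)
  set ε := (M ^ k) a₀ b₀ / (p a₀ * l b₀) with hε
  have hεpos : 0 < ε := div_pos (hpos _ _) (mul_pos (hp _) (hl _))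
  have hεle : ∀ a b, 0 ≤ (M ^ k) a b - ε * (p a * l b) := fun a b =>
    sub_nonneg.2 ((le_div_iff₀ (mul_pos (hp a) (hl b))).1 (hmin (a, b)))
  have hcol : ∀ b, ∑ a, l a * ((M ^ k) a b - ε * (p a * l b)) = (r ^ k - ε * (l ⬝ᵥ p)) * l b := by
    intro b
    have h1 := congrFun hMlk b
    simp only [Matrix.vecMul, dotProduct, Pi.smul_apply, smul_eq_mul] at h1 ⊢
    simp only [mul_sub, Finset.sum_sub_distrib, h1, sub_mul]
    congr 1
    rw [Finset.mul_sum, Finset.sum_mul]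
    exact Finset.sum_congr rfl fun a _ => by ring
  have hstep : ∀ m, r ^ k * N m ≤ (r ^ k - ε * (l ⬝ᵥ p)) * N (m + k) := by
    intro m
    have h1 : ∀ a, r ^ k * |d m a| ≤ ∑ b, ((M ^ k) a b - ε * (p a * l b)) * |d (m + k) b| := by
      intro a
      have h2 : r ^ k * d m a = ∑ b, ((M ^ k) a b - ε * (p a * l b)) * d (m + k) b := by
        have h3 := congrFun (hd m) a
        have h4 := hd0 (m + k)
        simp only [Matrix.mulVec, dotProduct, Pi.smul_apply, smul_eq_mul] at h3 h4
        simp only [sub_mul, Finset.sum_sub_distrib, h3]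
        have h5 : ∑ b, ε * (p a * l b) * d (m + k) b = ε * p a * ∑ b, l b * d (m + k) b := by
          rw [Finset.mul_sum]
          exact Finset.sum_congr rfl fun b _ => by ring
        rw [h5, h4, mul_zero, sub_zero]
      have h6 : r ^ k * |d m a| = |r ^ k * d m a| := by
        rw [abs_mul, abs_of_pos (pow_pos hr k)]
      rw [h6, h2]
      refine (Finset.abs_sum_le_sum_abs _ _).trans_eq (Finset.sum_congr rfl fun b _ => ?_)
      rw [abs_mul, abs_of_nonneg (hεle a b)]
    calc r ^ k * N m = ∑ a, l a * (r ^ k * |d m a|) := by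
          simp only [N, Finset.mul_sum]
          exact Finset.sum_congr rfl fun a _ => by ring
      _ ≤ ∑ a, l a * ∑ b, ((M ^ k) a b - ε * (p a * l b)) * |d (m + k) b| :=
          Finset.sum_le_sum fun a _ => mul_le_mul_of_nonneg_left (h1 a) (hl a).le
      _ = ∑ b, (∑ a, l a * ((M ^ k) a b - ε * (p a * l b))) * |d (m + k) b| := by
          simp only [Finset.mul_sum, Finset.sum_mul]
          rw [Finset.sum_comm]
          exact Finset.sum_congr rfl fun b _ => Finset.sum_congr rfl fun a _ => by ring
      _ = (r ^ k - ε * (l ⬝ᵥ p)) * N (m + k) := by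
          simp only [hcol, N, Finset.mul_sum]
          exact Finset.sum_congr rfl fun b _ => by ring
  have hN0 : ∀ m, 0 ≤ N m := fun m =>
    Finset.sum_nonneg fun a _ => mul_nonneg (hl a).le (abs_nonneg _)
  have ht0 : 0 ≤ t := div_nonneg (Finset.sum_nonneg fun a _ => mul_nonneg (hl a).le (h0 0 a)) hlp.le
  have hNB : ∀ m, N m ≤ 2 * (l ⬝ᵥ h 0) := by
    intro m
    have h1 : ∀ a, l a * |d m a| ≤ l a * (r ^ m • h m) a + t * (l a * p a) := by
      intro a
      have h2 : |d m a| ≤ |(r ^ m • h m) a| + |t * p a| := abs_sub _ _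
      have h3 : 0 ≤ (r ^ m • h m) a := mul_nonneg (pow_pos hr m).le (h0 m a)
      rw [abs_of_nonneg h3, abs_of_nonneg (mul_nonneg ht0 (hp a).le)] at h2
      nlinarith [mul_le_mul_of_nonneg_left h2 (hl a).le]
    refine (Finset.sum_le_sum fun a _ => h1 a).trans_eq ?_
    rw [Finset.sum_add_distrib, ← Finset.mul_sum]
    change l ⬝ᵥ (r ^ m • h m) + t * (l ⬝ᵥ p) = _
    rw [hconst, ht, div_mul_cancel₀ _ hlp.ne']
    ring
  set θ := 1 - ε * (l ⬝ᵥ p) / r ^ k with hθ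
  have hrk : 0 < r ^ k := pow_pos hr k
  have hθeq : r ^ k - ε * (l ⬝ᵥ p) = r ^ k * θ := by
    rw [hθ]; field_simp
  have hθ1 : θ < 1 := by
    have : 0 < ε * (l ⬝ᵥ p) / r ^ k := by positivity
    linarith
  have hθ0 : 0 ≤ θ := by
    have h1 : 0 ≤ (r ^ k - ε * (l ⬝ᵥ p)) * l b₀ := by
      rw [← hcol]
      exact Finset.sum_nonneg fun a _ => mul_nonneg (hl a).le (hεle a b₀)
    have h2 := nonneg_of_mul_nonneg_left h1 (hl b₀)
    rw [hθeq] at h2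
    exact nonneg_of_mul_nonneg_right h2 hrk
  have hstep' : ∀ m, N m ≤ θ * N (m + k) := fun m => by
    have h1 := hstep m
    rw [hθeq, mul_assoc] at h1
    exact le_of_mul_le_mul_left h1 hrk
  -- The orbit runs backwards, so the deviation at m is bounded by θ^j times a later one; as all are
  -- bounded, it is zero.
  have hiter : ∀ j m, N m ≤ θ ^ j * (2 * (l ⬝ᵥ h 0)) := by
    intro j
    induction j with
    | zero => intro m; simpa using hNB m
    | succ j ih =>
      intro m
      refine (hstep' m).trans ?_
      rw [pow_succ', mul_assoc]
      exact mul_le_mul_of_nonneg_left (ih _) hθ0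
  have hNm : N m = 0 := by
    have hlim := (tendsto_pow_atTop_nhds_zero_of_lt_one hθ0 hθ1).mul_const (2 * (l ⬝ᵥ h 0))
    rw [zero_mul] at hlim
    exact le_antisymm (ge_of_tendsto' hlim fun j => hiter j m) (hN0 m)
  have hdm : d m = 0 := by
    funext a
    have := (Finset.sum_eq_zero_iff_of_nonneg
      fun a _ => mul_nonneg (hl a).le (abs_nonneg (d m a))).1 hNm a (Finset.mem_univ a)
    rcases mul_eq_zero.1 this with h1 | h1
    · exact absurd h1 (hl a).ne'
    · exact abs_eq_zero.1 h1
  exact sub_eq_zero.1 hdm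

end PerronFrobenius

/-! ### Kakutani-Rohlin towers -/

section Towers

variable {A : Type*} {ξ : A → List A}

theorem Tiling.factor_take {τ : A → List A} {y x : ℤ → A} {c : ℤ → ℤ} (h : Tiling τ y x c) (j : ℤ)
    {k : ℕ} (hk : k < (τ (y j)).length) : factor x (c j) k = (τ (y j)).take k := by
  have hf := h.factor_one j
  obtain ⟨l, hl⟩ := Nat.exists_eq_add_of_lt hk
  rw [hl, add_assoc, factor_add] at hf
  exact List.prefix_iff_eq_take.1 ⟨_, hf⟩ |>.trans (by rw [length_factor])

theorem mem_towerPiece_iff {m k : ℕ} {b : A} {x : ℤ → A} :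
    x ∈ towerPiece ξ m k b ↔
      ∃ y ∈ Omega ξ, ∃ c, Tiling (substPow ξ m) y x c ∧ c 0 = -k ∧ y 0 = b := by
  constructor
  · rintro ⟨x', ⟨y, ⟨hy, hyb⟩, c, hc0, hc⟩, rfl⟩
    rw [shift_iterate]
    have h1 := Tiling.translate hc 0 k
    rw [translate_zero] at h1
    exact ⟨y, hy, _, h1, by simp [hc0], hyb⟩
  · rintro ⟨y, hy, c, hc, hc0, hyb⟩
    have h1 := hc.translate 0 (-k)
    rw [translate_zero] at h1
    refine ⟨translate (-k) x, ⟨y, ⟨hy, hyb⟩, isImage_iff.2 ⟨_, by simp [hc0], h1⟩⟩, ?_⟩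
    rw [shift_iterate, translate_translate]
    simp

theorem Recognizable.towerPiece_subset_Omega (h : Recognizable ξ) (m k : ℕ) (b : A) :
    towerPiece ξ m k b ⊆ Omega ξ := by
  intro x hx
  obtain ⟨y, hy, c, hc, -, -⟩ := mem_towerPiece_iff.1 hx
  exact hc.mem_Omega h.ne_nil hy

theorem Recognizable.exists_mem_towerPiece (h : Recognizable ξ) (m : ℕ) {x : ℤ → A}
    (hx : x ∈ Omega ξ) : ∃ b, ∃ k < (substPow ξ m b).length, x ∈ towerPiece ξ m k b := by
  obtain ⟨y, hy, c, hc⟩ := h.exists_tiling m hx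
  obtain ⟨s, k, hk, hc', h0⟩ := hc.center h.ne_nil 0
  exact ⟨_, k, hk, mem_towerPiece_iff.2 ⟨_, translate_mem_Omega s hy, _, hc', by simp [h0], rfl⟩⟩

/-- The two tilings differ by a translation of indices, and in both the tile of index 0 covers
coordinate 0, so the translation is trivial. -/
theorem Recognizable.eq_of_mem_towerPiece (h : Recognizable ξ) {m k k' : ℕ} {b b' : A} {x : ℤ → A}
    (hk : k < (substPow ξ m b).length) (hk' : k' < (substPow ξ m b').length)
    (hx : x ∈ towerPiece ξ m k b) (hx' : x ∈ towerPiece ξ m k' b') : b = b' ∧ k = k' := by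
  obtain ⟨y, hy, c, hc, hc0, rfl⟩ := mem_towerPiece_iff.1 hx
  obtain ⟨y', hy', c', hc', hc0', rfl⟩ := mem_towerPiece_iff.1 hx'
  obtain ⟨s, hs⟩ := h.unique hy hy' hc hc'
  have hmono := hc'.strictMono (h.length_pos m)
  have h1 := (hs 0).1
  have h2 := (hs 1).1
  have h3 := hc.1 0
  have h4 := hc'.1 0
  rw [zero_add] at h1 h3 h4
  have h5 : s < 1 := hmono.lt_iff_lt.1 (by omega)
  have h6 : 0 < 1 + s := hmono.lt_iff_lt.1 (by omega)
  obtain rfl : s = 0 := by omega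
  have h7 := (hs 0).2
  rw [add_zero] at h7
  exact ⟨h7.symm, by omega⟩

theorem apply_zero_of_mem_towerPiece {m k : ℕ} {b : A} {x : ℤ → A}
    (hk : k < (substPow ξ m b).length) (hx : x ∈ towerPiece ξ m k b) :
    x 0 = (substPow ξ m b)[k] := by
  obtain ⟨y, hy, c, hc, hc0, rfl⟩ := mem_towerPiece_iff.1 hx
  rw [← hc.2 0 k hk, hc0]
  simp

theorem towerPiece_zero (hne : ∀ b, ξ b ≠ []) (b : A) : towerPiece ξ 0 0 b = cyl ξ b := by
  ext x
  rw [mem_towerPiece_iff]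
  constructor
  · rintro ⟨y, hy, c, hc, hc0, rfl⟩
    have hx : x 0 = y 0 := by
      have := hc.2 0 0 (by simp)
      rw [hc0] at this
      simpa using this
    exact ⟨hc.mem_Omega hne hy, hx⟩
  · rintro ⟨hx, hxb⟩
    refine ⟨x, hx, fun j => j, ⟨by simp, ?_⟩, by simp, hxb⟩
    intro j k hk
    simp at hk
    subst hk
    simp

/-- The indices of the pieces of the tower of level `m`. -/
abbrev Index (ξ : A → List A) (m : ℕ) : Type _ := (b : A) × Fin (substPow ξ m b).length

/-- The letter at coordinate `0` of the points of a piece. -/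
def Index.letter {m : ℕ} (i : Index ξ m) : A := (substPow ξ m i.1)[i.2]

/-- The piece of a tower that belongs to an index. -/
def Index.piece {m : ℕ} (i : Index ξ m) : Set (ℤ → A) := towerPiece ξ m i.2 i.1

/-- The height in the tower of level `m + n` of the word `ξ ^ n (b)₀ ⋯ ξ ^ n (b)ₖ₋₁`. -/
def Index.height (m : ℕ) {n : ℕ} (i : Index ξ n) : ℕ :=
  (expand ξ m ((substPow ξ n i.1).take i.2)).length

theorem Index.height_lt (hne : ∀ b, ξ b ≠ []) (m : ℕ) {n : ℕ} (i : Index ξ n) :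
    i.height m < (substPow ξ (n + m) i.1).length := by
  rw [substPow_add, height]
  conv_rhs => rw [← List.take_append_drop (i.2 : ℕ) (substPow ξ n i.1)]
  rw [expand_append, List.length_append]
  have h1 := length_le_length_expand hne m ((substPow ξ n i.1).drop i.2)
  have h2 := i.2.2
  rw [List.length_drop] at h1
  omega

theorem Index.height_injective (hne : ∀ b, ξ b ≠ []) (m : ℕ) {n : ℕ} {i j : Index ξ n}
    (h1 : i.1 = j.1) (h2 : i.height m = j.height m) : i = j := by
  obtain ⟨b, k⟩ := i
  obtain ⟨b', l⟩ := j
  obtain rfl : b = b' := h1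
  have := eq_of_prefix_of_length_expand_eq hne m (List.take_prefix _ _) (List.take_prefix _ _) h2
  have h3 := congrArg List.length this
  simp only [List.length_take] at h3
  have := k.2
  have := l.2
  have : k = l := Fin.ext (by omega)
  rw [this]

theorem Index.height_zero {n : ℕ} (i : Index ξ n) : i.height 0 = i.2 := by
  have := i.2.2
  simp [height]

/-- A point of ξ^m([a]) is sorted by the occurrence of `a` in the word ξ^n(b) containing it; the
part of that word before the occurrence gives the height. -/
theorem Recognizable.towerPiece_eq_iUnion (h : Recognizable ξ) (m n : ℕ) (a : A) :
    towerPiece ξ m 0 a =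
      ⋃ i ∈ {i : Index ξ n | i.letter = a}, towerPiece ξ (n + m) (i.height m) i.1 := by
  ext x
  simp only [Set.mem_iUnion, Set.mem_ofPred_eq, exists_prop, mem_towerPiece_iff]
  constructor
  · rintro ⟨y, hy, e, he, he0, rfl⟩
    obtain ⟨z, hz, d, hd⟩ := h.exists_tiling n hy
    obtain ⟨s, k, hk, hd', h0⟩ := hd.center h.ne_nil 0
    have hz' := translate_mem_Omega (ξ := ξ) s hz
    set b := translate s z 0 with hb
    have ht : factor y (-k) k = (substPow ξ n b).take k := by
      rw [← hd'.factor_take 0 hk, zero_add, h0, zero_sub]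
    refine ⟨⟨b, ⟨k, hk⟩⟩, ?_, _, hz', _, he.comp hd', ?_, rfl⟩
    · have := hd'.2 0 k hk
      simp only [zero_add, h0, zero_sub, neg_add_cancel] at this
      exact this.symm
    · have h1 := he.apply_add (-k) k
      rw [neg_add_cancel, ht, he0] at h1
      simp only [Function.comp_apply, zero_add, h0, zero_sub, Index.height]
      simp only [Nat.cast_zero, neg_zero] at h1
      omega
  · rintro ⟨⟨b, k⟩, rfl, z, hz, c, hc, hc0, hzb⟩
    simp only at hzb
    subst hzb
    obtain ⟨y, d, e, he, hd, rfl⟩ := hc.split h.ne_nil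
    have hy := hd.mem_Omega h.ne_nil hz
    have ht := hd.factor_take 0 k.2
    have h1 := he.translate (d 0 + k) 0
    rw [translate_zero] at h1
    refine ⟨_, translate_mem_Omega _ hy, _, h1, ?_, ?_⟩
    · have h2 := he.apply_add (d 0) k
      rw [ht] at h2
      simp only [Function.comp_apply, Index.height] at hc0
      rw [zero_add, h2]
      simp only [Nat.cast_zero, neg_zero, sub_zero]
      omega
    · rw [translate_apply, zero_add]
      exact hd.2 0 k k.2

theorem Recognizable.cyl_eq_iUnion (h : Recognizable ξ) (n : ℕ) (a : A) :
    cyl ξ a = ⋃ i ∈ {i : Index ξ n | i.letter = a}, i.piece := by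
  rw [← towerPiece_zero h.ne_nil, h.towerPiece_eq_iUnion 0 n a]
  simp only [Index.height_zero, add_zero, Index.piece]

theorem Recognizable.disjoint_piece (h : Recognizable ξ) {m : ℕ} {i j : Index ξ m} (hij : i ≠ j) :
    Disjoint i.piece j.piece := by
  refine Set.disjoint_left.2 fun x hi hj => hij ?_
  obtain ⟨b, k⟩ := i
  obtain ⟨b', k'⟩ := j
  obtain ⟨rfl, h2⟩ := h.eq_of_mem_towerPiece k.2 k'.2 hi hj
  have : k = k' := Fin.ext h2
  rw [this]

theorem sum_index_letter [Fintype A] [DecidableEq A] (n : ℕ) (a : A) (g : A → ℝ) :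
    ∑ i : Index ξ n with i.letter = a, g i.1 = (incidence ξ ^ n).mulVec g a := by
  have key : ∀ (w : List A) (r : ℝ), ∑ k : Fin w.length, (if w[k] = a then r else 0) =
      ((w.count a : ℕ) : ℝ) * r := by
    intro w r
    induction w with
    | nil => simp
    | cons c w ih =>
      simp only [List.length_cons, Fin.sum_univ_succ, List.count_cons]
      have h1 := ih
      simp only [Fin.getElem_fin, Fin.val_zero, List.getElem_cons_zero, Fin.val_succ,
        List.getElem_cons_succ] at h1 ⊢
      rw [h1]
      by_cases hc : c = a <;> (simp [hc]; try ring)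
  rw [Finset.sum_filter, Fintype.sum_sigma]
  simp only [Matrix.mulVec, dotProduct, incidence_pow_apply, ← key]
  rfl

end Towers

/-! ### Topology of the subshift and of the pieces -/

section Topology

theorem exists_window_of_isOpen {A : Type*} [TopologicalSpace A] {U : Set (ℤ → A)} (hU : IsOpen U) {x : ℤ → A} (hx : x ∈ U) :
    ∃ R : ℕ, ∀ y, (∀ i : ℤ, |i| ≤ R → y i = x i) → y ∈ U := by
  obtain ⟨I, u, hu, hsub⟩ := isOpen_pi_iff.1 hU x hx
  refine ⟨∑ i ∈ I, i.natAbs, fun y hy => hsub fun i hi => ?_⟩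
  have h1 : i.natAbs ≤ ∑ i ∈ I, i.natAbs :=
    Finset.single_le_sum (f := fun i : ℤ => i.natAbs) (fun _ _ => Nat.zero_le _) hi
  have h2 : |i| = (i.natAbs : ℤ) := Int.abs_eq_natAbs i
  rw [hy i (by rw [h2]; exact_mod_cast h1)]
  exact (hu i hi).2

theorem continuous_shift {A : Type*} [TopologicalSpace A] : Continuous (shift : (ℤ → A) → (ℤ → A)) :=
  continuous_pi fun i => continuous_apply (i + 1)

variable {A : Type*} [TopologicalSpace A] [DiscreteTopology A] {ξ : A → List A}

theorem isOpen_of_window {S : Set (ℤ → A)}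
    (h : ∀ x ∈ S, ∃ R : ℕ, ∀ y, (∀ i : ℤ, |i| ≤ R → y i = x i) → y ∈ S) : IsOpen S := by
  rw [isOpen_iff_mem_nhds]
  intro x hx
  obtain ⟨R, hR⟩ := h x hx
  have h1 : Set.pi (Set.Icc (-R : ℤ) R) (fun i => {x i}) ∈ 𝓝 x :=
    set_pi_mem_nhds (Set.finite_Icc _ _) fun i _ => (isOpen_discrete _).mem_nhds rfl
  filter_upwards [h1] with y hy
  exact hR y fun i hi => hy i (abs_le.1 hi)

theorem isClosed_Omega (ξ : A → List A) : IsClosed (Omega ξ) := by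
  rw [← isOpen_compl_iff]
  refine isOpen_of_window fun x hx => ?_
  simp only [Set.mem_compl_iff, Omega, Set.mem_ofPred_eq, not_forall] at hx
  obtain ⟨i, n, hin⟩ := hx
  refine ⟨i.natAbs + n, fun y hy hyO => hin ?_⟩
  rw [← factor_ext (x := y) fun k hk => hy (i + k) (abs_le.2 (by omega))]
  exact hyO i n

variable [Finite A]

theorem isCompact_cyl (ξ : A → List A) (a : A) : IsCompact (cyl ξ a) := by
  have h : IsClosed {x : ℤ → A | x 0 = a} := 
    (isClosed_discrete {a}).preimage (f := fun x : ℤ → A => x 0) (continuous_apply 0)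
  exact ((isClosed_Omega ξ).inter h).isCompact

/-- Applying ξ^m is continuous, since a coordinate i of the image depends only on the letters with
index at most |i| in modulus. -/
theorem isCompact_towerPiece (hne : ∀ b, ξ b ≠ []) (m k : ℕ) (b : A) :
    IsCompact (towerPiece ξ m k b) := by
  choose f c hc0 hc using fun y => exists_tiling_at (m := m) hne y 0
  have hf : Continuous f := by
    refine continuous_pi fun i => ⟨fun s _ => ?_⟩
    refine isOpen_of_window fun y hy => ⟨i.natAbs, fun y' hy' => ?_⟩
    have h1 := (hc y').agree hne (hc y) ((hc0 y').trans (hc0 y).symm) hy' (i := i)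
      (by rw [hc0, sub_zero, Int.abs_eq_natAbs])
    rw [Set.mem_preimage, h1]
    exact hy
  have h1 : imagePow ξ m (cyl ξ b) = f '' cyl ξ b := by
    ext x
    constructor
    · rintro ⟨y, hy, d, hd0, hd⟩
      have hd' : Tiling (substPow ξ m) y x d := hd
      have h2 : d = c y := hd'.eq_of_apply_zero (hc y) (hd0.trans (hc0 y).symm)
      exact ⟨y, hy, (hd'.ext (length_substPow_pos hne m) (h2 ▸ hc y)).symm⟩
    · rintro ⟨y, hy, rfl⟩
      exact ⟨y, hy, c y, hc0 y, hc y⟩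
  rw [towerPiece, h1]
  exact ((isCompact_cyl ξ b).image hf).image (continuous_shift.iterate k)

end Topology

/-! ### Properness: the pieces generate the topology -/

section Generating

variable {A : Type*} {ξ : A → List A}

/-- Whatever the neighbouring letters are, the preceding tile ends with ξ^m(q) and the following one
begins with ξ^m(p). So the piece determines its points beyond both ends of the central tile. -/
theorem eq_of_mem_towerPiece_of_isProper (hprop : IsProper ξ) {m R : ℕ}
    (hR : ∀ a, R < (substPow ξ m a).length) {k : ℕ} {b : A} (hk : k < (substPow ξ (1 + m) b).length)
    {x x' : ℤ → A} (hx : x ∈ towerPiece ξ (1 + m) k b) (hx' : x' ∈ towerPiece ξ (1 + m) k b) {i : ℤ}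
    (hi : |i| ≤ R) : x i = x' i := by
  obtain ⟨⟨p, hp⟩, ⟨q, hq⟩⟩ := hprop
  have key : ∀ {x : ℤ → A}, x ∈ towerPiece ξ (1 + m) k b →
      factor x (-k - (substPow ξ m q).length) ((substPow ξ m q).length +
        (substPow ξ (1 + m) b).length + (substPow ξ m p).length) =
        substPow ξ m q ++ substPow ξ (1 + m) b ++ substPow ξ m p := by
    intro x hx
    obtain ⟨y, hy, c, hc, hc0, rfl⟩ := mem_towerPiece_iff.1 hx
    have h0 := hc.factor_one 0
    have h1 := hc.factor_one 1
    have h2 := hc.factor_one (-1)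
    have e1 := hc.1 0
    have e2 := hc.1 (-1)
    obtain ⟨t, ht⟩ := List.head?_eq_some_iff.1 (hp (y 1))
    obtain ⟨s, hs⟩ := List.getLast?_eq_some_iff.1 (hq (y (-1)))
    have f1 : substPow ξ (1 + m) (y 1) = substPow ξ m p ++ expand ξ m t := by
      rw [substPow_add, substPow_one, ht, expand_cons]
    have f2 : substPow ξ (1 + m) (y (-1)) = expand ξ m s ++ substPow ξ m q := by
      rw [substPow_add, substPow_one, hs, expand_append, expand_singleton]
    rw [neg_add_cancel] at e2
    rw [zero_add] at e1
    rw [f1, List.length_append, factor_add] at h1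
    rw [f2, List.length_append, factor_add] at h2
    rw [f2, List.length_append] at e2
    have g1 := (List.append_inj h1 (by simp)).1
    have g2 := (List.append_inj h2 (by simp)).2
    rw [factor_add, factor_add]
    congr 1
    · congr 1
      · rw [← g2]
        simp only [length_factor]
        congr 1
        push_cast at e2
        omega
      · rw [← h0]
        simp only [length_factor]
        congr 1
        omega
    · rw [← g1]
      simp only [length_factor]
      congr 1
      push_cast
      omega
  have h1 := (key hx).trans (key hx').symm
  have hp' := hR p
  have hq' := hR q
  rw [abs_le] at hi
  obtain ⟨l, hl⟩ := Int.le.dest (show -(k : ℤ) - (substPow ξ m q).length ≤ i by omega)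
  have h2 := eq_of_factor_eq h1 (k := l) (by omega)
  rwa [hl] at h2

theorem eventually_piece_window [Finite A] (hξ : IsSubstitution ξ) (hprop : IsProper ξ) (R : ℕ) :
    ∀ᶠ m in atTop, ∀ i : Index ξ m, ∀ x ∈ i.piece, ∀ x' ∈ i.piece, ∀ t : ℤ, |t| ≤ R →
      x t = x' t := by
  have h1 : ∀ᶠ m in atTop, ∀ a, R < (substPow ξ m a).length :=
    eventually_all.2 fun a => (hξ.2 a).eventually_gt_atTop R
  refine (tendsto_sub_atTop_nat 1).eventually h1 |>.and (eventually_ge_atTop 1) |>.mono ?_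
  rintro m ⟨hm, hm1⟩ i x hx x' hx' t ht
  obtain ⟨m, rfl⟩ := Nat.exists_eq_add_of_le hm1
  rw [Nat.add_sub_cancel_left] at hm
  exact eq_of_mem_towerPiece_of_isProper hprop hm i.2.2 hx hx' ht

end Generating

/-! ### Invariant measure of the pieces -/

section Measure

variable {A : Type*} [Fintype A] [TopologicalSpace A] [DiscreteTopology A]
  [MeasurableSpace A] [BorelSpace A] {ξ : A → List A} {μ : Measure (ℤ → A)}

theorem measurableSet_towerPiece (hne : ∀ b, ξ b ≠ []) (m k : ℕ) (b : A) :
    MeasurableSet (towerPiece ξ m k b) :=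
  (isCompact_towerPiece hne m k b).measurableSet

theorem IsInvariantProb.measure_towerPiece (hμ : IsInvariantProb ξ μ) (hne : ∀ b, ξ b ≠ [])
    (m k : ℕ) (b : A) : μ (towerPiece ξ m k b) = μ (towerPiece ξ m 0 b) := by
  have hinj : Function.Injective (shift^[k] : (ℤ → A) → (ℤ → A)) := by
    intro x y hxy
    rw [shift_iterate, shift_iterate] at hxy
    have := congrArg (translate (-k)) hxy
    simpa [translate_translate] using this
  rw [← (hμ.invariant.iterate k).measure_preimage (measurableSet_towerPiece hne m k b).nullMeasurableSet,
    towerPiece, Set.preimage_image_eq _ hinj, towerPiece, Function.iterate_zero, Set.image_id]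

variable [DecidableEq A]

/-- By invariance all floors of a tower have the measure of its base, so the base measures form a
backward orbit of M. -/
theorem Recognizable.measureReal_towerPiece (h : Recognizable ξ) (hμ : IsInvariantProb ξ μ)
    (m n : ℕ) (a : A) :
    μ.real (towerPiece ξ m 0 a) =
      (incidence ξ ^ n).mulVec (fun b => μ.real (towerPiece ξ (n + m) 0 b)) a := by
  have := hμ.prob
  rw [← sum_index_letter, h.towerPiece_eq_iUnion m n a]
  have e : (⋃ i ∈ {i : Index ξ n | i.letter = a}, towerPiece ξ (n + m) (i.height m) i.1) =
      ⋃ i ∈ ({i : Index ξ n | i.letter = a} : Finset (Index ξ n)),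
        towerPiece ξ (n + m) (i.height m) i.1 := by
    simp
  rw [e, measureReal_biUnion_finset]
  · refine Finset.sum_congr rfl fun i _ => ?_
    simp only [measureReal_def, hμ.measure_towerPiece h.ne_nil]
  · intro i _ j _ hij
    refine Set.disjoint_left.2 fun x hi hj => hij ?_
    obtain ⟨h1, h2⟩ := h.eq_of_mem_towerPiece (Index.height_lt h.ne_nil m i)
      (Index.height_lt h.ne_nil m j) hi hj
    exact Index.height_injective h.ne_nil m h1 h2
  · exact fun i _ => measurableSet_towerPiece h.ne_nil _ _ _

end Measure

/-! ### Continuity of F -/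

section Continuity

variable {A : Type*} [Fintype A] [TopologicalSpace A] [DiscreteTopology A]
  {ξ : A → List A}

theorem Recognizable.piece_mem_nhdsWithin (h : Recognizable ξ) {m : ℕ} (i : Index ξ m) {x : ℤ → A}
    (hx : x ∈ i.piece) : i.piece ∈ 𝓝[Omega ξ] x := by
  have h1 : IsClosed (⋃ j ∈ {j : Index ξ m | j ≠ i}, j.piece) :=
    (Set.toFinite _).isClosed_biUnion fun j _ => (isCompact_towerPiece h.ne_nil _ _ _).isClosed
  have h2 : x ∉ ⋃ j ∈ {j : Index ξ m | j ≠ i}, j.piece := by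
    simp only [Set.mem_iUnion, not_exists]
    exact fun j hj hxj => Set.disjoint_left.1 (h.disjoint_piece hj) hxj hx
  filter_upwards [nhdsWithin_le_nhds (h1.isOpen_compl.mem_nhds h2), self_mem_nhdsWithin]
    with y hy hyO
  obtain ⟨b, k, hk, hyp⟩ := h.exists_mem_towerPiece m hyO
  by_contra hne
  refine hy (Set.mem_biUnion (x := (⟨b, ⟨k, hk⟩⟩ : Index ξ m)) (fun hEq => hne ?_) hyp)
  rw [← hEq]
  exact hyp

variable [DecidableEq A]

/-- On a relatively open piece of level m the function varies only through the sum for (M^t)^m w,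
which is bounded by a tail of a convergent series. -/
theorem Recognizable.continuousOn_pairingSum (h : Recognizable ξ) {w : A → ℝ}
    (hw : IsDecaying ξ w) : ContinuousOn (pairingSum ξ w) (Omega ξ) := by
  intro x hx
  obtain ⟨L, hL⟩ := exists_length_le ξ 1
  rw [ContinuousWithinAt, Metric.tendsto_nhds]
  intro ε hε
  have h1 : Tendsto (fun m => 2 * (L * ∑' k, ‖(transposeMap ξ ^ (k + m)) w‖)) atTop (𝓝 0) := by
    have := ((tendsto_sum_nat_add fun k => ‖(transposeMap ξ ^ k) w‖).const_mul (L : ℝ)).const_mul 2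
    simpa using this
  obtain ⟨m, hm⟩ := (h1.eventually_lt_const hε).exists
  obtain ⟨b, k, hk, hxp⟩ := h.exists_mem_towerPiece m hx
  filter_upwards [h.piece_mem_nhdsWithin (⟨b, ⟨k, hk⟩⟩ : Index ξ m) hxp] with x' hxp'
  refine lt_of_le_of_lt ?_ hm
  change x' ∈ towerPiece ξ m k b at hxp'
  obtain ⟨u, ⟨y, ⟨hy, hyb⟩, hu⟩, rfl⟩ := hxp
  obtain ⟨u', ⟨y', ⟨hy', hyb'⟩, hu'⟩, rfl⟩ := hxp'
  rw [h.pairingSum_tower hw hy hu (hyb ▸ hk), h.pairingSum_tower hw hy' hu' (hyb' ▸ hk), hyb, hyb',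
    Real.dist_eq, sub_sub_sub_cancel_right]
  have e1 := h.abs_pairingSum_le (hw.pow m) hL hy
  have e2 := h.abs_pairingSum_le (hw.pow m) hL hy'
  simp only [← Module.End.mul_apply, ← pow_add] at e1 e2
  have := abs_sub (pairingSum ξ ((transposeMap ξ ^ m) w) y') (pairingSum ξ ((transposeMap ξ ^ m) w) y)
  linarith

theorem Recognizable.continuousOn_F (h : Recognizable ξ) {n : ℕ} (α : Fin n → ℝ) :
    ContinuousOn (F ξ α) (Omega ξ) := by
  refine continuousOn_pi.2 fun i => ?_
  exact (h.continuousOn_pairingSum (isDecaying_stableImage ξ (α i))).congr fun x hx =>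
    h.F_apply α hx i

end Continuity

/-! ### Volumes of the images of pieces -/

section Scaling

variable {A : Type*} [Fintype A] [DecidableEq A] {ξ : A → List A}

/-- A linear relation between the stable parts passes to the coordinates of F, whose image then lies
in a hyperplane. -/
theorem Recognizable.volume_image_eq_zero (h : Recognizable ξ) {n : ℕ} {α : Fin n → ℝ}
    {c : Fin n → ℝ} (hc : ∑ i, c i • stablePart ξ (α i) = 0) (hc0 : c ≠ 0) {X : Set (ℤ → A)}
    (hX : X ⊆ Omega ξ) : volume (F ξ α '' X) = 0 := by
  have h1 : ∑ i, c i • stableImage ξ (α i) = 0 := by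
    simpa [stableImage] using congrArg (transposeMap ξ) hc
  let φ : (Fin n → ℝ) →ₗ[ℝ] ℝ := ∑ i, c i • LinearMap.proj i
  have hφ : ∀ u, φ u = ∑ i, c i * u i := fun u => by simp [φ]
  have hsub : F ξ α '' X ⊆ (LinearMap.ker φ : Set (Fin n → ℝ)) := by
    rintro _ ⟨x, hx, rfl⟩
    rw [SetLike.mem_coe, LinearMap.mem_ker, hφ]
    simp only [h.F_apply α (hX hx)]
    rw [← h.pairingSum_sum c (fun i => isDecaying_stableImage ξ (α i)) (hX hx), h1]
    simp [pairingSum, pairing]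
  refine measure_mono_null hsub (Measure.addHaar_submodule _ _ fun htop => hc0 ?_)
  funext i
  have h2 : φ (Pi.single i 1) = 0 := by
    rw [← LinearMap.mem_ker, htop]; trivial
  rw [hφ] at h2
  simpa [Pi.single_apply] using h2

theorem transposeMap_pow_eq_sum {n : ℕ} {w : Fin n → A → ℝ} {B : Matrix (Fin n) (Fin n) ℝ}
    (hw : ∀ i, transposeMap ξ (w i) = ∑ j, B i j • w j) (m : ℕ) (i : Fin n) :
    (transposeMap ξ ^ m) (w i) = ∑ j, (B ^ m) i j • w j := by
  induction m generalizing i with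
  | zero => simp [Matrix.one_apply]
  | succ m ih =>
    rw [pow_succ, Module.End.mul_apply, hw, map_sum]
    simp only [map_smul, ih, pow_succ', Matrix.mul_apply, Finset.smul_sum, Finset.sum_smul,
      smul_smul]
    exact Finset.sum_comm

/-- On a piece, F is B^m applied to F at the desubstituted point, followed by a translation
depending on the piece only. -/
theorem Recognizable.volume_image_towerPiece_of_eq_sum (h : Recognizable ξ) {n : ℕ} {α : Fin n → ℝ}
    {B : Matrix (Fin n) (Fin n) ℝ}
    (hB : ∀ i, transposeMap ξ (stableImage ξ (α i)) = ∑ j, B i j • stableImage ξ (α j))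
    {m k : ℕ} {b : A} (hk : k < (substPow ξ m b).length) :
    volume (F ξ α '' towerPiece ξ m k b) =
      ENNReal.ofReal (|B.det| ^ m) * volume (F ξ α '' cyl ξ b) := by
  have hpow := transposeMap_pow_eq_sum hB m
  let t : Fin n → ℝ := fun i => weight (stableImage ξ (α i)) ((substPow ξ m b).take k)
  have key : ∀ x y : ℤ → A, y ∈ cyl ξ b → IsImage (substPow ξ m) y x →
      F ξ α (shift^[k] x) = (-t) + Matrix.toLin' (B ^ m) (F ξ α y) := by
    intro x y hy hx
    have hk' : k < (substPow ξ m (y 0)).length := by rw [hy.2]; exact hk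
    have hxO : shift^[k] x ∈ Omega ξ := h.towerPiece_subset_Omega m k b ⟨x, ⟨y, hy, hx⟩, rfl⟩
    funext i
    rw [h.F_apply α hxO, h.pairingSum_tower (isDecaying_stableImage ξ (α i)) hy.1 hx hk', hpow,
      h.pairingSum_sum _ (fun j => isDecaying_stableImage ξ (α j)) hy.1, hy.2]
    simp only [Pi.add_apply, Pi.neg_apply, Matrix.toLin'_apply, Matrix.mulVec, dotProduct, t,
      h.F_apply α hy.1]
    ring
  have hset : F ξ α '' towerPiece ξ m k b =
      (fun u => -t + u) '' (Matrix.toLin' (B ^ m) '' (F ξ α '' cyl ξ b)) := by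
    ext u
    constructor
    · rintro ⟨_, ⟨x, ⟨y, hy, hx⟩, rfl⟩, rfl⟩
      exact ⟨_, ⟨_, ⟨y, hy, rfl⟩, rfl⟩, (key x y hy hx).symm⟩
    · rintro ⟨_, ⟨_, ⟨y, hy, rfl⟩, rfl⟩, rfl⟩
      obtain ⟨x, c, hc0, hc⟩ := exists_tiling_at (m := m) h.ne_nil y 0
      exact ⟨_, ⟨x, ⟨y, hy, c, hc0, hc⟩, rfl⟩, key x y hy ⟨c, hc0, hc⟩⟩
  rw [hset, Set.image_add_left, measure_preimage_add, Measure.addHaar_image_linearMap,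
    LinearMap.det_toLin', Matrix.det_pow, abs_pow]

/-- If the stable parts form a basis of the stable space, their matrix has determinant `detEs ξ`. If
they are dependent, both volumes vanish. -/
theorem Recognizable.volume_image_towerPiece (h : Recognizable ξ) {n : ℕ} {α : Fin n → ℝ}
    (hn : Module.finrank ℝ (Es ξ) = n) (hn0 : 0 < n)
    {m k : ℕ} {b : A} (hk : k < (substPow ξ m b).length) :
    volume (F ξ α '' towerPiece ξ m k b) =
      ENNReal.ofReal (|detEs ξ| ^ m) * volume (F ξ α '' cyl ξ b) := by
  let v : Fin n → Es ξ := fun i => ⟨stablePart ξ (α i), stablePart_mem_Es ξ (α i)⟩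
  by_cases hv : LinearIndependent ℝ v
  · have : Nonempty (Fin n) := ⟨⟨0, hn0⟩⟩
    let e := basisOfLinearIndependentOfCardEqFinrank hv (by simp [hn])
    have he : ∀ i, e i = v i := fun i => by simp [e]
    let f := (transposeMap ξ).restrict (transposeMap_mem_Es ξ)
    have hdet : (LinearMap.toMatrix e e f).transpose.det = detEs ξ := by
      rw [Matrix.det_transpose, LinearMap.det_toMatrix]; rfl
    rw [← hdet]
    refine h.volume_image_towerPiece_of_eq_sum (fun i => ?_) hk
    have h1 := e.sum_repr (f (e i))
    have h2 := congrArg (fun u : Es ξ => transposeMap ξ (u : A → ℝ)) h1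
    simp only [Submodule.coe_sum, map_sum, Submodule.coe_smul, map_smul, he] at h2
    simp only [Matrix.transpose_apply, LinearMap.toMatrix_apply, he]
    exact h2.symm
  · obtain ⟨c, hc, i, hi⟩ := Fintype.not_linearIndependent_iff.1 hv
    have h1 : ∑ i, c i • stablePart ξ (α i) = 0 := by
      have := congrArg (Submodule.subtype _) hc
      simpa [v] using this
    have hc0 : c ≠ 0 := fun h0 => hi (congrFun h0 i)
    rw [h.volume_image_eq_zero h1 hc0 (h.towerPiece_subset_Omega m k b),
      h.volume_image_eq_zero h1 hc0 fun x hx => hx.1, mul_zero]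

end Scaling

/-! ### Decomposition of a cylinder into the pieces that meet it -/

section Pieces

variable {A : Type*} {ξ : A → List A}

theorem towerPiece_subset_cyl (h : Recognizable ξ) {m : ℕ} {a : A} {p : A × ℕ}
    (hp : p ∈ towerIndex ξ m a) : towerPiece ξ m p.2 p.1 ⊆ cyl ξ a := by
  obtain ⟨hlt, x, hxa, hxp⟩ := hp
  intro y hy
  refine ⟨h.towerPiece_subset_Omega _ _ _ hy, ?_⟩
  rw [apply_zero_of_mem_towerPiece hlt hy, ← apply_zero_of_mem_towerPiece hlt hxp]
  exact hxa.2

theorem cyl_eq_biUnion_towerIndex (h : Recognizable ξ) (m : ℕ) (a : A) :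
    cyl ξ a = ⋃ p ∈ towerIndex ξ m a, towerPiece ξ m p.2 p.1 := by
  refine Set.Subset.antisymm (fun x hx => ?_) (Set.iUnion₂_subset fun p hp =>
    towerPiece_subset_cyl h hp)
  obtain ⟨b, k, hk, hxp⟩ := h.exists_mem_towerPiece m hx.1
  exact Set.mem_biUnion (x := (b, k)) ⟨hk, x, hx, hxp⟩ hxp

end Pieces

/-! ### Comparison of volume and invariant measure -/

section Conclusion

variable {A : Type*} [Fintype A] [TopologicalSpace A] [DiscreteTopology A]
  [MeasurableSpace A] [BorelSpace A] {ξ : A → List A} {μ : Measure (ℤ → A)}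

/-- Volumes and measures of the cylinders are both multiples of the Perron vector, and both scale by
1/β per level. -/
theorem Recognizable.exists_volume_image_towerPiece_eq [DecidableEq A] (h : Recognizable ξ)
    (hμ : IsInvariantProb ξ μ) {n : ℕ} {α : Fin n → ℝ} (hP : HypothesesP ξ μ α) :
    ∃ C : ℝ≥0, ∀ (m k : ℕ) (b : A), k < (substPow ξ m b).length →
      volume (F ξ α '' towerPiece ξ m k b) = C * μ (towerPiece ξ m k b) := by
  have := hμ.prob
  obtain ⟨x₀, hx₀⟩ := hμ.ae_mem_Omega.exists
  have : Nonempty A := ⟨x₀ 0⟩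
  obtain ⟨β, hβ, hdet⟩ := hP.unimodular
  obtain ⟨r, hr, p, hp, hMp⟩ := exists_pos_eigenvector hP.primitive
  obtain rfl := hβ.eq hr hp hMp
  have hdet' : |detEs ξ| = β⁻¹ := eq_inv_of_mul_eq_one_right hdet
  have hscale : ∀ (m k : ℕ) (b : A), k < (substPow ξ m b).length →
      volume (F ξ α '' towerPiece ξ m k b) =
        ENNReal.ofReal (β⁻¹ ^ m) * volume (F ξ α '' cyl ξ b) := fun m k b hk => by
    rw [← hdet']
    exact h.volume_image_towerPiece hP.dim_stable hP.pos hk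
  have hfin : ∀ a, volume (F ξ α '' cyl ξ a) ≠ ⊤ := fun a =>
    ((isCompact_cyl ξ a).image_of_continuousOn
      ((h.continuousOn_F α).mono fun x hx => hx.1)).measure_ne_top
  let Λ : A → ℝ := fun a => volume.real (F ξ α '' cyl ξ a)
  obtain ⟨k, -, hkpos⟩ := hP.primitive.exists_pos_pow
  -- Overlaps of the images are not yet controlled, so only subadditivity is available;
  -- Perron-Frobenius turns the inequality into proportionality.
  obtain ⟨t, ht⟩ := exists_eq_smul_of_le hp hMp hkpos (u := Λ) fun a => by
    have h1 : F ξ α '' cyl ξ a =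
        ⋃ i ∈ ({i : Index ξ k | i.letter = a} : Finset (Index ξ k)), F ξ α '' i.piece := by
      rw [h.cyl_eq_iUnion k a]
      simp [Set.image_iUnion]
    have h2 : Λ a ≤ ∑ i : Index ξ k with i.letter = a, volume.real (F ξ α '' i.piece) := by
      simp only [Λ, h1]
      exact measureReal_biUnion_finset_le _ _
    have h3 : ∀ i : Index ξ k, volume.real (F ξ α '' i.piece) = β⁻¹ ^ k * Λ i.1 := fun i => by
      rw [measureReal_def, Index.piece, hscale k i.2 i.1 i.2.2, ENNReal.toReal_mul,
        ENNReal.toReal_ofReal (by positivity)]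
      rfl
    simp only [h3] at h2
    rw [← Finset.mul_sum, sum_index_letter, inv_pow, le_inv_mul_iff₀ (by positivity)] at h2
    exact h2
  obtain ⟨s, hs⟩ := exists_eq_smul_of_backward_orbit hP.primitive hr hp hMp
    (h := fun m b => μ.real (towerPiece ξ m 0 b)) (fun _ _ => measureReal_nonneg) fun m => by
      funext a
      rw [h.measureReal_towerPiece hμ m 1 a, pow_one, add_comm 1 m]
  have hs' : ∀ m b, β ^ m * μ.real (towerPiece ξ m 0 b) = s * p b := fun m b => congrFun (hs m) b
  have ht' : ∀ b, Λ b = t * p b := fun b => congrFun ht b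
  have hs0 : s ≠ 0 := by
    rintro rfl
    have h1 : μ (Omega ξ) = 0 := by
      have h2 : Omega ξ = ⋃ a, cyl ξ a := by
        ext x
        simp [cyl]
      rw [h2, measure_iUnion_null_iff]
      intro a
      have h3 := hs' 0 a
      rw [towerPiece_zero h.ne_nil, pow_zero, one_mul, zero_mul, measureReal_eq_zero_iff] at h3
      exact h3
    have h2 : μ Set.univ = 0 := by
      rw [← Set.union_compl_self (Omega ξ)]
      exact measure_union_null h1 hμ.support
    rw [measure_univ] at h2
    exact one_ne_zero h2
  have hspos : 0 < s := by
    refine lt_of_le_of_ne ?_ hs0.symm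
    have h1 : 0 ≤ s * p (x₀ 0) := by
      rw [← hs' 0]; positivity
    exact nonneg_of_mul_nonneg_left h1 (hp _)
  have htnn : 0 ≤ t := by
    have h1 : 0 ≤ t * p (x₀ 0) := by
      rw [← ht']; exact measureReal_nonneg
    exact nonneg_of_mul_nonneg_left h1 (hp _)
  refine ⟨(t / s).toNNReal, fun m k b hk => ?_⟩
  have h1 : volume (F ξ α '' cyl ξ b) = ENNReal.ofReal (t * p b) := by
    rw [← ht', ofReal_measureReal (hfin b)]
  have h2 : μ (towerPiece ξ m 0 b) = ENNReal.ofReal (β⁻¹ ^ m * (s * p b)) := by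
    rw [← hs' m b, inv_pow, inv_mul_cancel_left₀ (by positivity), ofReal_measureReal]
  rw [hscale m k b hk, h1, hμ.measure_towerPiece h.ne_nil, h2,
    ← ENNReal.ofReal, ← ENNReal.ofReal_mul (by positivity), ← ENNReal.ofReal_mul (by positivity)]
  congr 1
  field_simp

/-- A point of `U` has all its pieces of high level inside `U`. The sets `V m` of points for which
this holds from level m on increase to U ∩ Ω, and each is covered by disjoint pieces contained in
`U`. -/
theorem Recognizable.volume_image_isOpen_le (h : Recognizable ξ) {E : Type*} [MeasurableSpace E]
    {ν : Measure E} {Φ : (ℤ → A) → E} {C : ℝ≥0} (hξ : IsSubstitution ξ) (hprop : IsProper ξ)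
    (hC : ∀ (m k : ℕ) (b : A), k < (substPow ξ m b).length →
      ν (Φ '' towerPiece ξ m k b) = C * μ (towerPiece ξ m k b))
    {U : Set (ℤ → A)} (hU : IsOpen U) : ν (Φ '' (U ∩ Omega ξ)) ≤ C * μ U := by
  classical
  let V : ℕ → Set (ℤ → A) := fun m =>
    {x | x ∈ Omega ξ ∧ ∀ m' ≥ m, ∀ i : Index ξ m', x ∈ i.piece → i.piece ⊆ U}
  have hV : Monotone V := fun m m' hm x hx => ⟨hx.1, fun l hl => hx.2 l (hm.trans hl)⟩
  have hcover : U ∩ Omega ξ ⊆ ⋃ m, V m := by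
    rintro x ⟨hxU, hxO⟩
    obtain ⟨R, hR⟩ := exists_window_of_isOpen hU hxU
    obtain ⟨m, hm⟩ := eventually_atTop.1 (eventually_piece_window hξ hprop R)
    exact Set.mem_iUnion.2 ⟨m, hxO, fun m' hm' i hi y hy =>
      hR y fun j hj => hm m' hm' i y hy x hi j hj⟩
  refine (measure_mono (Set.image_mono hcover)).trans ?_
  have hmono : Monotone fun m => Φ '' V m := fun m m' hm => Set.image_mono (hV hm)
  -- Continuity along increasing unions holds for arbitrary sets, so the images need not be known to
  -- be measurable.
  rw [Set.image_iUnion, hmono.measure_iUnion]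
  refine iSup_le fun m => ?_
  let I : Finset (Index ξ m) := {i | i.piece ⊆ U}
  have h1 : Φ '' V m ⊆ ⋃ i ∈ I, Φ '' i.piece := by
    rintro _ ⟨x, hx, rfl⟩
    obtain ⟨b, k, hk, hxp⟩ := h.exists_mem_towerPiece m hx.1
    have h2 := hx.2 m le_rfl ⟨b, ⟨k, hk⟩⟩ hxp
    exact Set.mem_biUnion (x := (⟨b, ⟨k, hk⟩⟩ : Index ξ m)) (by simpa [I] using h2) ⟨x, hxp, rfl⟩
  calc ν (Φ '' V m) ≤ ν (⋃ i ∈ I, Φ '' i.piece) := measure_mono h1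
    _ ≤ ∑ i ∈ I, ν (Φ '' i.piece) := measure_biUnion_finset_le _ _
    _ = C * ∑ i ∈ I, μ i.piece := by
        rw [Finset.mul_sum]
        exact Finset.sum_congr rfl fun i _ => hC m i.2 i.1 i.2.2
    _ = C * μ (⋃ i ∈ I, i.piece) := by
        rw [measure_biUnion_finset (fun i _ j _ hij => h.disjoint_piece hij)
          fun i _ => measurableSet_towerPiece h.ne_nil _ _ _]
    _ ≤ C * μ U := by
        gcongr
        simp [I]

theorem Recognizable.volume_image_le (h : Recognizable ξ) {E : Type*} [MeasurableSpace E]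
    {ν : Measure E} {Φ : (ℤ → A) → E} {C : ℝ≥0} [IsFiniteMeasure μ] (hξ : IsSubstitution ξ)
    (hprop : IsProper ξ)
    (hC : ∀ (m k : ℕ) (b : A), k < (substPow ξ m b).length →
      ν (Φ '' towerPiece ξ m k b) = C * μ (towerPiece ξ m k b))
    {B : Set (ℤ → A)} (hB : B ⊆ Omega ξ) : ν (Φ '' B) ≤ C * μ B := by
  refine ENNReal.le_of_forall_pos_le_add fun ε hε _ => ?_
  have hC1 : (0 : ℝ≥0) < C + 1 := by positivity
  obtain ⟨U, hBU, hU, hUB⟩ := B.exists_isOpen_lt_add (measure_ne_top μ B)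
    (ε := (ε / (C + 1) : ℝ≥0)) (by simpa using hε.ne')
  calc ν (Φ '' B) ≤ ν (Φ '' (U ∩ Omega ξ)) :=
        measure_mono (Set.image_mono (Set.subset_inter hBU hB))
    _ ≤ C * μ U := h.volume_image_isOpen_le hξ hprop hC hU
    _ ≤ C * (μ B + (ε / (C + 1) : ℝ≥0)) := by gcongr
    _ = C * μ B + (C * (ε / (C + 1)) : ℝ≥0) := by rw [mul_add]; push_cast; rfl
    _ ≤ C * μ B + ε := by
        gcongr
        rw [mul_div_assoc', div_le_iff₀ hC1, mul_comm]
        gcongr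
        simp

/-- The upper bounds for `B` and its complement in [a] add up to the exact value for [a], which
leaves no slack. -/
theorem Recognizable.volume_image_eq (h : Recognizable ξ) {E : Type*} [MeasurableSpace E]
    {ν : Measure E} {Φ : (ℤ → A) → E} {C : ℝ≥0} [IsFiniteMeasure μ] (hξ : IsSubstitution ξ)
    (hprop : IsProper ξ)
    (hC : ∀ (m k : ℕ) (b : A), k < (substPow ξ m b).length →
      ν (Φ '' towerPiece ξ m k b) = C * μ (towerPiece ξ m k b))
    {a : A} {B : Set (ℤ → A)} (hBm : MeasurableSet B) (hB : B ⊆ cyl ξ a) :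
    ν (Φ '' B) = C * μ B := by
  refine le_antisymm (h.volume_image_le hξ hprop hC fun x hx => (hB hx).1) ?_
  have h1 : ν (Φ '' cyl ξ a) = C * μ (cyl ξ a) := by
    rw [← towerPiece_zero h.ne_nil]
    exact hC 0 0 a (by simp)
  have h2 : μ (cyl ξ a) = μ B + μ (cyl ξ a \ B) := by
    rw [← measure_inter_add_sdiff (cyl ξ a) hBm, Set.inter_eq_self_of_subset_right hB]
  have h3 : ν (Φ '' cyl ξ a) ≤ ν (Φ '' B) + C * μ (cyl ξ a \ B) := by
    refine le_trans (le_trans (measure_mono ?_) (measure_union_le (Φ '' B) (Φ '' (cyl ξ a \ B))))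
      (add_le_add_right (h.volume_image_le hξ hprop hC fun x hx => hx.1.1) _)
    rw [← Set.image_union, Set.union_sdiff_self]
    exact Set.image_mono Set.subset_union_right
  rw [h1, h2, mul_add] at h3
  exact (ENNReal.add_le_add_iff_right
    (ENNReal.mul_ne_top ENNReal.coe_ne_top (measure_ne_top μ _))).1 h3

/-- By inner regularity `B` is a countable union of compact sets up to a μ-null set. Compact sets
have compact images, and the image of the null set is null by `Recognizable.volume_image_le`. -/
theorem Recognizable.nullMeasurableSet_image (h : Recognizable ξ) {n : ℕ} {ν : Measure (Fin n → ℝ)}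
    {Φ : (ℤ → A) → (Fin n → ℝ)} {C : ℝ≥0} [IsFiniteMeasure μ] (hξ : IsSubstitution ξ)
    (hprop : IsProper ξ) (hΦ : ContinuousOn Φ (Omega ξ))
    (hC : ∀ (m k : ℕ) (b : A), k < (substPow ξ m b).length →
      ν (Φ '' towerPiece ξ m k b) = C * μ (towerPiece ξ m k b))
    {B : Set (ℤ → A)} (hBm : MeasurableSet B) (hB : B ⊆ Omega ξ) :
    NullMeasurableSet (Φ '' B) ν := by
  have hε : ∀ j : ℕ, ((j : ENNReal) + 1)⁻¹ ≠ 0 := fun j => by simp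
  choose K hKB hK hμK using fun j : ℕ =>
    hBm.exists_isCompact_sdiff_lt (measure_ne_top μ B) (hε j)
  have h1 : Φ '' B = (⋃ j, Φ '' K j) ∪ Φ '' (B \ ⋃ j, K j) := by
    rw [← Set.image_iUnion, ← Set.image_union, Set.union_sdiff_cancel (Set.iUnion_subset hKB)]
  have h2 : μ (B \ ⋃ j, K j) = 0 := by
    by_contra hne
    obtain ⟨j, hj⟩ := ENNReal.exists_inv_nat_lt hne
    refine absurd ((measure_mono (Set.sdiff_subset_sdiff_right (Set.subset_iUnion K j))).trans_lt
      ((hμK j).trans_le ?_)) (lt_asymm hj)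
    gcongr
    exact le_self_add
  have h3 : ν (Φ '' (B \ ⋃ j, K j)) = 0 := by
    have := h.volume_image_le hξ hprop hC (Set.sdiff_subset.trans hB : B \ ⋃ j, K j ⊆ Omega ξ)
    rw [h2, mul_zero] at this
    exact le_antisymm this zero_le
  rw [h1]
  refine (NullMeasurableSet.iUnion fun j => ?_).union (NullMeasurableSet.of_null h3)
  exact ((hK j).image_of_continuousOn
    (hΦ.mono ((hKB j).trans hB))).measurableSet.nullMeasurableSet

/-- For the union of two disjoint pieces, `Recognizable.volume_image_eq` makes the volume of the
image additive; all volumes are finite, so the overlap is null. -/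
theorem Recognizable.measure_inter_eq_zero (h : Recognizable ξ) {n : ℕ} {ν : Measure (Fin n → ℝ)}
    {Φ : (ℤ → A) → (Fin n → ℝ)} {C : ℝ≥0} [IsFiniteMeasure μ] (hξ : IsSubstitution ξ)
    (hprop : IsProper ξ) (hΦ : ContinuousOn Φ (Omega ξ))
    (hC : ∀ (m k : ℕ) (b : A), k < (substPow ξ m b).length →
      ν (Φ '' towerPiece ξ m k b) = C * μ (towerPiece ξ m k b))
    {m : ℕ} {a : A} {p q : A × ℕ} (hp : p ∈ towerIndex ξ m a) (hq : q ∈ towerIndex ξ m a)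
    (hpq : p ≠ q) :
    ν ((Φ '' towerPiece ξ m p.2 p.1) ∩ (Φ '' towerPiece ξ m q.2 q.1)) = 0 := by
  have hmeas := fun p : A × ℕ => measurableSet_towerPiece h.ne_nil m p.2 p.1
  have hdisj : Disjoint (towerPiece ξ m p.2 p.1) (towerPiece ξ m q.2 q.1) :=
    Set.disjoint_left.2 fun x hx hx' => hpq <| by
      obtain ⟨h1, h2⟩ := h.eq_of_mem_towerPiece hp.1 hq.1 hx hx'
      exact Prod.ext h1 h2
  have h1 := h.volume_image_eq hξ hprop hC ((hmeas p).union (hmeas q))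
    (Set.union_subset (towerPiece_subset_cyl h hp) (towerPiece_subset_cyl h hq))
  rw [measure_union hdisj (hmeas q), mul_add, ← hC m p.2 p.1 hp.1, ← hC m q.2 q.1 hq.1,
    Set.image_union] at h1
  have h2 : MeasurableSet (Φ '' towerPiece ξ m q.2 q.1) :=
    ((isCompact_towerPiece h.ne_nil _ _ _).image_of_continuousOn
      (hΦ.mono (h.towerPiece_subset_Omega _ _ _))).measurableSet
  have h3 := measure_union_add_inter (μ := ν) (Φ '' towerPiece ξ m p.2 p.1) h2
  rw [h1] at h3
  have hfin : ∀ p ∈ towerIndex ξ m a, ν (Φ '' towerPiece ξ m p.2 p.1) ≠ ⊤ := fun p hp => by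
    rw [hC m p.2 p.1 hp.1]
    exact ENNReal.mul_ne_top ENNReal.coe_ne_top (measure_ne_top μ _)
  exact (ENNReal.add_right_inj (ENNReal.add_ne_top.2 ⟨hfin p hp, hfin q hq⟩)).1
    (h3.trans (add_zero _).symm)

end Conclusion

end PrimSubst

end

theorem mainTheorem8 {A : Type*} [Fintype A] [DecidableEq A] [MeasurableSpace A]
    [DiscreteMeasurableSpace A] (ξ : A → List A) (μ : Measure (ℤ → A))
    (hμ : PrimSubst.IsInvariantProb ξ μ) {n : ℕ} (α : Fin n → ℝ)
    (hP : PrimSubst.HypothesesP ξ μ α) :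
    (∀ x ∈ PrimSubst.Omega ξ, Summable (PrimSubst.Fterm ξ α x)) ∧
    ∃ C : ℝ≥0, ∀ a : A,
      volume (PrimSubst.F ξ α '' PrimSubst.cyl ξ a) = C * μ (PrimSubst.cyl ξ a) ∧
      (∃ N : ℕ, ∀ m ≥ N,
        PrimSubst.F ξ α '' PrimSubst.cyl ξ a =
            ⋃ p ∈ PrimSubst.towerIndex ξ m a, PrimSubst.F ξ α '' PrimSubst.towerPiece ξ m p.2 p.1 ∧
          ∀ p ∈ PrimSubst.towerIndex ξ m a, ∀ q ∈ PrimSubst.towerIndex ξ m a, p ≠ q →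
            volume ((PrimSubst.F ξ α '' PrimSubst.towerPiece ξ m p.2 p.1) ∩
              (PrimSubst.F ξ α '' PrimSubst.towerPiece ξ m q.2 q.1)) = 0) ∧
      ∀ B : Set (ℤ → A), MeasurableSet B → B ⊆ PrimSubst.cyl ξ a →
        NullMeasurableSet (PrimSubst.F ξ α '' B) volume ∧
          volume (PrimSubst.F ξ α '' B) = C * μ B := by
  -- The discrete topology on the alphabet supplies compactness of the sequence space and regularity
  -- of μ.
  let _ : TopologicalSpace A := ⊥
  have : DiscreteTopology A := ⟨rfl⟩
  have := hμ.prob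
  have h : PrimSubst.Recognizable ξ := hP.recognizable hμ
  refine ⟨fun x hx => h.summable_Fterm α hx, ?_⟩
  obtain ⟨C, hC⟩ := h.exists_volume_image_towerPiece_eq hμ hP
  -- The decomposition holds at every level, so 0 serves as the threshold.
  refine ⟨C, fun a => ⟨?_, ⟨0, fun m _ => ⟨?_, fun p hp q hq hpq => ?_⟩⟩, fun B hBm hB => ⟨?_, ?_⟩⟩⟩
  · rw [← PrimSubst.towerPiece_zero h.ne_nil]
    exact hC 0 0 a (by simp)
  · conv_lhs => rw [PrimSubst.cyl_eq_biUnion_towerIndex h m a]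
    simp only [Set.image_iUnion]
  · exact h.measure_inter_eq_zero hP.substitution hP.proper (h.continuousOn_F α) hC hp hq hpq
  · exact h.nullMeasurableSet_image hP.substitution hP.proper (h.continuousOn_F α) hC hBm
      fun x hx => (hB hx).1
  · exact h.volume_image_eq hP.substitution hP.proper hC hBm hB
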